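/- **Theorem (expected error and running time of the averaging estimator).** Let $A\in\mathbb{R}^{n\times d}$ have full column rank, $b\in\mathbb{R}^n$, $f(x)=\|Ax-b\|_2^2$, $x^*=\arg\min_x f(x)$, and suppose $f(x^*)>0$. Let $m>d+1$, $q\ge 1$, and let $S_1,\dots,S_q\in\mathbb{R}^{m\times n}$ be i.i.d. Gaussian sketching matrices, i.e. all entries of all $S_k$ are independent with law $\mathcal N(0,1/m)$ (variance $1/m$, so $\mathbb E[S_k^TS_k]=I_n$). In distributed randomized regression, worker $k=1,\dots,q$ obtains the sketched data $S_kA$, $S_kb$ and solves $\hat x_k\in\arg\min_x\|S_kAx-S_kb\|_2^2$ (workers run in parallel), and the master node returns $\bar x=\frac1q\sum_{k=1}^q\hat x_k$. 1. *Running time.* The algorithm runs in parallel time $O(md^2)$ from the sketched data, the master's averaging being counted separately. Precisely, in the real-RAM model (unit cost for each exact arithmetic operation, comparison, index operation and loop step) there are a fixed worker program, a fixed master program and a universal constant $C$ such that for all $1\le d\le m$, all $q\ge1$ and all inputs $(M_k,y_k)\in\mathbb{R}^{m\times d}\times\mathbb{R}^m$, $k=1,\dots,q$: worker $k$, given $(M_k,y_k)$,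 returns a minimizer of $\|M_kx-y_k\|_2^2$ after at most $C\,md^2$ steps, and the master, given the $q$ returned vectors, returns their average after at most $C\,qd$ further steps. 2. *Expected error.* For every choice of (almost surely) least-squares solutions $\hat x_k$ of the sketched problems, $f(\bar x)$ is integrable and $$\frac{\mathbb E[f(\bar x)]-f(x^*)}{f(x^*)}=\frac1q\,\frac{d}{m-d-1}.$$ 3. *Probability bound.* For every $\epsilon>0$, $$\mathbb P\left(\frac{f(\bar x)-f(x^*)}{f(x^*)}\le\epsilon\right)\ \ge\ 1-\frac{1}{q\epsilon}\,\frac{d}{m-d-1}.$$ -/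

import Mathlib

open MeasureTheory ProbabilityTheory
open scoped NNReal

noncomputable section

namespace Sketching

/-! ### Least squares and Gaussian sketches -/

/-- The least squares objective `f(x) = ‖A x - b‖₂²` (Euclidean norm). -/
def lsObjective {n d : ℕ} (A : Matrix (Fin n) (Fin d) ℝ) (b : Fin n → ℝ) (x : Fin d → ℝ) : ℝ :=
  ‖WithLp.toLp 2 (A.mulVec x - b)‖ ^ 2

/-- `x` is a global minimizer of `‖A x - b‖₂²`, that is, `x ∈ argmin ‖A x - b‖₂²`. -/
def IsLeastSquaresSolution {n d : ℕ} (A : Matrix (Fin n) (Fin d) ℝ) (b : Fin n → ℝ)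
    (x : Fin d → ℝ) : Prop :=
  ∀ z : Fin d → ℝ, lsObjective A b x ≤ lsObjective A b z

/-- The average `(1/q) ∑ₖ xₖ` of `q` vectors. -/
def vectorAverage {q d : ℕ} (x : Fin q → Fin d → ℝ) : Fin d → ℝ :=
  (1 / (q : ℝ)) • ∑ k, x k

/-- `S₁, …, S_q` are i.i.d. Gaussian sketching matrices of size `m × n`: all entries of all the
matrices are mutually independent with law `N(0, 1/m)` (variance `1/m`, so that
`E[Sₖᵀ Sₖ] = I`). -/
structure IsIIDGaussianSketches {Ω : Type*} [MeasurableSpace Ω] (P : Measure Ω) {q m n : ℕ}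
    (S : Fin q → Ω → Matrix (Fin m) (Fin n) ℝ) : Prop where
  hasLaw : ∀ k i j, HasLaw (fun ω => S k ω i j) (gaussianReal 0 ((m : ℝ≥0)⁻¹)) P
  indep : iIndepFun (fun (p : Fin q × Fin m × Fin n) (ω : Ω) => S p.1 ω p.2.1 p.2.2) P

/-! ### A real random access machine with a step count

Programs of a structured imperative language over exact real arithmetic. A state has index
registers holding natural numbers and two-dimensional arrays of reals. A program is a fixed finite
piece of syntax, independent of the size of its input; every elementary operation (index or real
arithmetic, test, loop bookkeeping) costs one step. Every program terminates. -/

/-- A machine state: `idx r` is the content of index register `r`, and `mem a i j` is the entry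
`(i, j)` of the real array `a`. -/
structure State where
  idx : ℕ → ℕ
  mem : ℕ → ℕ → ℕ → ℝ

/-- A reference to a real memory cell: the array `arr`, at the position whose row and column are
the current contents of the index registers `row` and `col`. -/
structure Cell where
  arr : ℕ
  row : ℕ
  col : ℕ

/-- The arithmetic operations on reals. -/
inductive ArithOp
  | add
  | sub
  | mul
  | div

/-- The value of an arithmetic operation. Division by zero returns zero; as programs can test for
zero, this convention only saves such a test. -/
def ArithOp.eval : ArithOp → ℝ → ℝ → ℝ
  | .add, x, y => x + y
  | .sub, x, y => x - y
  | .mul, x, y => x * y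
  | .div, x, y => x / y

/-- Programs. -/
inductive Cmd
  /-- do nothing -/
  | skip
  /-- index register `r := c`, a constant -/
  | idxConst (r c : ℕ)
  /-- index register `r := s + t` -/
  | idxAdd (r s t : ℕ)
  /-- index register `r := s - t`, truncated at zero -/
  | idxSub (r s t : ℕ)
  /-- real cell `x := c`, a constant -/
  | const (x : Cell) (c : ℚ)
  /-- real cell `x := y op z` -/
  | arith (op : ArithOp) (x y z : Cell)
  /-- `c₁ ; c₂` -/
  | seq (c₁ c₂ : Cmd)
  /-- `if x ≤ y then c₁ else c₂`, a comparison of two real cells -/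
  | ifLe (x y : Cell) (c₁ c₂ : Cmd)
  /-- `for r = 0, …, N - 1 do c`, where `N` is the content of the index register `s` on entry -/
  | loop (r s : ℕ) (c : Cmd)

/-- Write the index register `r`. -/
def State.setIdx (σ : State) (r v : ℕ) : State :=
  { σ with idx := Function.update σ.idx r v }

/-- Read a real cell. -/
def State.get (σ : State) (x : Cell) : ℝ :=
  σ.mem x.arr (σ.idx x.row) (σ.idx x.col)

/-- Write a real cell. -/
def State.set (σ : State) (x : Cell) (v : ℝ) : State :=
  { σ with mem := fun a i j =>
      if a = x.arr ∧ i = σ.idx x.row ∧ j = σ.idx x.col then v else σ.mem a i j }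

/-- `iter f N a = f (N - 1) (⋯ (f 1 (f 0 a)))`. -/
def iter {α : Type*} (f : ℕ → α → α) : ℕ → α → α
  | 0, a => a
  | N + 1, a => f N (iter f N a)

open Classical in
/-- Execution of a program from a state: the final state and the number of steps. -/
def Cmd.exec : Cmd → State → State × ℕ
  | .skip, σ => (σ, 1)
  | .idxConst r c, σ => (σ.setIdx r c, 1)
  | .idxAdd r s t, σ => (σ.setIdx r (σ.idx s + σ.idx t), 1)
  | .idxSub r s t, σ => (σ.setIdx r (σ.idx s - σ.idx t), 1)
  | .const x c, σ => (σ.set x (c : ℝ), 1)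
  | .arith op x y z, σ => (σ.set x (op.eval (σ.get y) (σ.get z)), 1)
  | .seq c₁ c₂, σ =>
      ((c₂.exec (c₁.exec σ).1).1, (c₁.exec σ).2 + (c₂.exec (c₁.exec σ).1).2)
  | .ifLe x y c₁ c₂, σ =>
      if σ.get x ≤ σ.get y then ((c₁.exec σ).1, (c₁.exec σ).2 + 1)
      else ((c₂.exec σ).1, (c₂.exec σ).2 + 1)
  | .loop r s c, σ =>
      iter (fun i p => ((c.exec (p.1.setIdx r i)).1, p.2 + (c.exec (p.1.setIdx r i)).2 + 1))
        (σ.idx s) (σ, 1)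

/-- The first two index registers hold the sizes `M` and `N`, and the others hold `0`. -/
def sizeRegisters (M N : ℕ) : ℕ → ℕ
  | 0 => M
  | 1 => N
  | _ => 0

/-- The `r × c` array with the entries of a matrix, padded with zeros. -/
def matrixArray {r c : ℕ} (M : Matrix (Fin r) (Fin c) ℝ) (i j : ℕ) : ℝ :=
  if h : i < r ∧ j < c then M ⟨i, h.1⟩ ⟨j, h.2⟩ else 0

/-- The array with the entries of a vector in its column `0`, padded with zeros. -/
def vectorArray {r : ℕ} (y : Fin r → ℝ) (i j : ℕ) : ℝ :=
  if h : i < r ∧ j = 0 then y ⟨i, h.1⟩ else 0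

/-- The output of a program: the vector in column `0` of array `2` of the final state. -/
def outputVector (d : ℕ) (σ : State) : Fin d → ℝ := fun j => σ.mem 2 j 0

/-! ### Distributed randomized regression -/

/-- The initial state of a worker: the sizes `m`, `d`, the sketched matrix `M = S A` in array `0`
and the sketched vector `y = S b` in array `1`. -/
def workerInput {m d : ℕ} (M : Matrix (Fin m) (Fin d) ℝ) (y : Fin m → ℝ) : State where
  idx := sizeRegisters m d
  mem
    | 0 => matrixArray M
    | 1 => vectorArray y
    | _ => fun _ _ => 0

/-- The vector that a worker sends to the master node. -/
def workerOutput (worker : Cmd) {m d : ℕ} (M : Matrix (Fin m) (Fin d) ℝ) (y : Fin m → ℝ) :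
    Fin d → ℝ :=
  outputVector d (worker.exec (workerInput M y)).1

/-- The number of steps of a worker. -/
def workerTime (worker : Cmd) {m d : ℕ} (M : Matrix (Fin m) (Fin d) ℝ) (y : Fin m → ℝ) : ℕ :=
  (worker.exec (workerInput M y)).2

/-- The initial state of the master node: the sizes `q`, `d`, and the vectors received from the
`q` workers as the rows of array `0`. -/
def masterInput {q d : ℕ} (x : Fin q → Fin d → ℝ) : State where
  idx := sizeRegisters q d
  mem
    | 0 => matrixArray (Matrix.of x)
    | _ => fun _ _ => 0

/-- The vector that the master node returns. -/
def masterOutput (master : Cmd) {q d : ℕ} (x : Fin q → Fin d → ℝ) : Fin d → ℝ :=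
  outputVector d (master.exec (masterInput x)).1

/-- The number of steps of the master node. -/
def masterTime (master : Cmd) {q d : ℕ} (x : Fin q → Fin d → ℝ) : ℕ :=
  (master.exec (masterInput x)).2

end Sketching

end

/-!
The excess `f(x) - f(x*)` is `‖A (x - x*)‖²`. With an orthonormal basis `u₁, …, u_d` of the column
space of `A` and the normalized residual `u₀ = (b - A x*) / √f(x*)`, which is orthogonal to it, the
coordinates of `A (x̂ - x*) / √f(x*)` are the coefficients in the regression of the sketch `S u₀` on
the sketches `S u₁, …, S u_d` (`IsResidualFrame.errorCoord_eq_regressionCoeff`). Up to the factor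
`√m`, which does not change them, these sketches are independent standard Gaussian vectors in
`ℝᵐ` (`IsIIDGaussianSketches.hasLaw_sketchedVectors`).

The `j`-th regression coefficient is `⟪w, h⟫`, where `h` is the response and `w` is the `j`-th dual
vector of the regressors. Given the regressors it is centred with second moment `‖w‖²`, and `‖w‖⁻²`
is the squared distance of the `j`-th regressor to the span of the other ones, a chi-squared
variable with `m - d + 1` degrees of freedom. The mean of its inverse is `1 / (m - d - 1)`
(`lintegral_inv_norm_sq_stdGaussian`, `lintegral_regressionCoeff_sq`). Summing over `j`, and
averaging over `q` independent workers, gives `d / (q (m - d - 1))`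
(`IsIIDGaussianSketches.integral_average_regressionCoeff_sq`); the probability bound is Markov's
inequality.

The worker runs the modified Gram-Schmidt process, without normalization, on the columns of
`[M, y; I, 0]`, with inner products over the first `m` rows. As each column keeps the form
`(M z, z)`, or `(y + M z, z)` for the last one, the last column ends as `(y - M x, -x)` with
`y - M x` orthogonal to the columns of `M` (`isLeastSquaresSolution_gramSchmidtArray`). This is `d²`
column operations on columns of length `m + d ≤ 2 m`, and it needs no assumption on the rank of
`M`: a vanishing pivot column is skipped, since the quotient by its squared norm is zero.
-/

namespace Sketching


/-! ### Gaussian integrals -/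

/-- The Laplace transform of the square of a standard normal variable. -/
lemma integral_exp_neg_mul_sq_gaussianReal {t : ℝ} (ht : 0 ≤ t) :
    ∫ x, Real.exp (-t * x ^ 2) ∂(gaussianReal 0 1) = (1 + 2 * t) ^ (-(1 / 2) : ℝ) := by
  rw [integral_gaussianReal_eq_integral_smul (by norm_num)]
  have h (x : ℝ) : gaussianPDFReal 0 1 x • Real.exp (-t * x ^ 2)
      = (√(2 * Real.pi))⁻¹ * Real.exp (-(1 / 2 + t) * x ^ 2) := by
    simp only [gaussianPDFReal, smul_eq_mul, NNReal.coe_one, mul_one, sub_zero, mul_assoc,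
      ← Real.exp_add]
    congr 3
    ring
  simp_rw [h]
  rw [integral_const_mul, integral_gaussian, Real.rpow_neg (by positivity), ← Real.sqrt_eq_rpow,
    ← Real.sqrt_inv, ← Real.sqrt_inv, ← Real.sqrt_mul (by positivity)]
  congr 1
  have := Real.pi_pos
  field_simp

variable {F : Type*} [NormedAddCommGroup F] [InnerProductSpace ℝ F] [FiniteDimensional ℝ F]
  [MeasurableSpace F] [BorelSpace F]

/-- The Laplace transform of `‖x‖²` for a standard Gaussian vector `x`. -/
lemma integral_exp_neg_mul_norm_sq_stdGaussian {t : ℝ} (ht : 0 ≤ t) :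
    ∫ x, Real.exp (-t * ‖x‖ ^ 2) ∂(stdGaussian F)
      = (1 + 2 * t) ^ (-(Module.finrank ℝ F : ℝ) / 2) := by
  have hnorm (x : Fin (Module.finrank ℝ F) → ℝ) :
      ‖∑ i, x i • stdOrthonormalBasis ℝ F i‖ ^ 2 = ∑ i, x i ^ 2 := by
    rw [← (stdOrthonormalBasis ℝ F).sum_sq_norm_inner_right]
    refine Finset.sum_congr rfl fun i _ => ?_
    rw [(stdOrthonormalBasis ℝ F).orthonormal.inner_right_fintype, Real.norm_eq_abs, sq_abs]
  rw [stdGaussian, integral_map (Measurable.aemeasurable (by fun_prop))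
    (Measurable.aestronglyMeasurable (by fun_prop))]
  simp_rw [hnorm, Finset.mul_sum, Real.exp_sum]
  rw [integral_fintype_prod_eq_prod (f := fun _ x => Real.exp (-t * x ^ 2))]
  simp_rw [integral_exp_neg_mul_sq_gaussianReal ht]
  rw [Finset.prod_const, Finset.card_univ, Fintype.card_fin, ← Real.rpow_natCast,
    ← Real.rpow_mul (by positivity)]
  congr 1
  ring

lemma lintegral_exp_neg_mul_Ioi {s : ℝ} (hs : 0 < s) :
    ∫⁻ t in Set.Ioi (0 : ℝ), ENNReal.ofReal (Real.exp (-t * s)) = ENNReal.ofReal (s⁻¹) := by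
  have h (t : ℝ) : Real.exp (-t * s) = Real.exp (-s * t) := by ring_nf
  simp_rw [h]
  rw [← ofReal_integral_eq_lintegral_ofReal (integrableOn_exp_mul_Ioi (by linarith) 0)
    (.of_forall fun _ => (Real.exp_pos _).le), integral_exp_mul_Ioi (by linarith)]
  simp

lemma lintegral_one_add_two_mul_rpow {k : ℝ} (hk : 2 < k) :
    ∫⁻ t in Set.Ioi (0 : ℝ), ENNReal.ofReal ((1 + 2 * t) ^ (-k / 2))
      = ENNReal.ofReal ((k - 2)⁻¹) := by
  have hk' : k - 2 ≠ 0 := by linarith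
  have hd : ∀ t ∈ Set.Ici (0 : ℝ), HasDerivAt
      (fun t : ℝ => -(k - 2)⁻¹ * (1 + 2 * t) ^ (1 - k / 2)) ((1 + 2 * t) ^ (-k / 2)) t := by
    intro t ht
    have ht' : (0 : ℝ) ≤ t := ht
    have h1 : HasDerivAt (fun t : ℝ => 1 + 2 * t) 2 t := by
      simpa using ((hasDerivAt_id t).const_mul 2).const_add 1
    refine ((h1.rpow_const (p := 1 - k / 2) (Or.inl (by positivity))).const_mul
      (-(k - 2)⁻¹)).congr_deriv ?_
    rw [show 1 - k / 2 - 1 = -k / 2 by ring]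
    field_simp
    ring
  have hlim : Filter.Tendsto (fun t : ℝ => -(k - 2)⁻¹ * (1 + 2 * t) ^ (1 - k / 2)) Filter.atTop
      (nhds 0) := by
    have h1 : Filter.Tendsto (fun t : ℝ => 1 + 2 * t) Filter.atTop Filter.atTop :=
      Filter.tendsto_atTop_add_const_left _ _ (Filter.tendsto_id.const_mul_atTop two_pos)
    have h2 := ((tendsto_rpow_neg_atTop (y := k / 2 - 1) (by linarith)).comp h1).const_mul
      (-(k - 2)⁻¹)
    simpa [Function.comp_def] using h2
  have hnn : ∀ t ∈ Set.Ioi (0 : ℝ), 0 ≤ (1 + 2 * t) ^ (-k / 2) := fun t ht =>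
    Real.rpow_nonneg (by have : (0 : ℝ) < t := ht; positivity) _
  have hint := integrableOn_Ioi_deriv_of_nonneg' hd hnn hlim
  rw [← ofReal_integral_eq_lintegral_ofReal hint
    ((ae_restrict_iff' measurableSet_Ioi).2 (.of_forall hnn)),
    integral_Ioi_of_hasDerivAt_of_tendsto' hd hint hlim]
  simp

/-- A proper subspace is a null set of the standard Gaussian measure. -/
lemma stdGaussian_submodule_eq_zero {V : Submodule ℝ F} (hV : V ≠ ⊤) :
    stdGaussian F (V : Set F) = 0 := by
  obtain ⟨u, hu, hu0⟩ : ∃ u ∈ Vᗮ, u ≠ 0 :=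
    Submodule.exists_mem_ne_zero_of_ne_bot (mt (Submodule.orthogonal_eq_bot_iff).1 hV)
  have hlaw : (stdGaussian F).map (innerSL ℝ u) = gaussianReal 0 (‖u‖₊ ^ 2) := by
    rw [IsGaussian.map_eq_gaussianReal, integral_strongDual_stdGaussian,
      variance_dual_stdGaussian]
    congr 1
    rw [innerSL_apply_norm]
    ext
    simp
  have hna : NullSingletonClass (gaussianReal 0 (‖u‖₊ ^ 2)) :=
    nullSingletonClass_gaussianReal (by simpa using hu0)
  refine measure_mono_null (t := innerSL ℝ u ⁻¹' {0}) ?_ ?_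
  · intro x hx
    simpa [real_inner_comm] using Submodule.inner_right_of_mem_orthogonal hx hu
  · rw [← Measure.map_apply (by fun_prop) (measurableSet_singleton _), hlaw, measure_singleton]

/-- The mean of the inverse of a chi-squared variable with `k = finrank F` degrees of freedom. It
follows from `s⁻¹ = ∫₀^∞ exp (-t s) dt` and the Laplace transform of `‖x‖²`. -/
lemma lintegral_inv_norm_sq_stdGaussian (hk : 2 < Module.finrank ℝ F) :
    ∫⁻ x, ENNReal.ofReal ((‖x‖ ^ 2)⁻¹) ∂(stdGaussian F)
      = ENNReal.ofReal (((Module.finrank ℝ F : ℝ) - 2)⁻¹) := by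
  have hne : ∀ᵐ x ∂(stdGaussian F), x ≠ 0 := by
    have : Nontrivial F := Module.nontrivial_of_finrank_pos (R := ℝ) (by omega)
    have h := stdGaussian_submodule_eq_zero (F := F) (V := ⊥) bot_ne_top
    rw [ae_iff]
    simpa using h
  calc ∫⁻ x, ENNReal.ofReal ((‖x‖ ^ 2)⁻¹) ∂(stdGaussian F)
      = ∫⁻ x, (∫⁻ t in Set.Ioi (0 : ℝ), ENNReal.ofReal (Real.exp (-t * ‖x‖ ^ 2)))
          ∂(stdGaussian F) := by
        refine lintegral_congr_ae ?_
        filter_upwards [hne] with x hx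
        rw [lintegral_exp_neg_mul_Ioi (by positivity)]
    _ = ∫⁻ t in Set.Ioi (0 : ℝ), (∫⁻ x, ENNReal.ofReal (Real.exp (-t * ‖x‖ ^ 2))
          ∂(stdGaussian F)) :=
        lintegral_lintegral_swap (Measurable.aemeasurable (by fun_prop))
    _ = ∫⁻ t in Set.Ioi (0 : ℝ),
          ENNReal.ofReal ((1 + 2 * t) ^ (-(Module.finrank ℝ F : ℝ) / 2)) := by
        refine setLIntegral_congr_fun measurableSet_Ioi fun t ht => ?_
        have ht' : (0 : ℝ) ≤ t := le_of_lt ht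
        rw [← integral_exp_neg_mul_norm_sq_stdGaussian ht', ofReal_integral_eq_lintegral_ofReal]
        · refine Integrable.of_bound (C := 1)
            (Measurable.aestronglyMeasurable (by fun_prop)) (.of_forall fun x => ?_)
          rw [Real.norm_eq_abs, abs_of_pos (Real.exp_pos _), Real.exp_le_one_iff]
          have := mul_nonneg ht' (sq_nonneg ‖x‖)
          linarith
        · exact .of_forall fun _ => (Real.exp_pos _).le
    _ = _ := lintegral_one_add_two_mul_rpow (by exact_mod_cast hk)

/-- The orthogonal projection of a standard Gaussian vector to a subspace is standard Gaussian. -/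
lemma map_orthogonalProjectionOnto_stdGaussian (V : Submodule ℝ F) :
    (stdGaussian F).map V.orthogonalProjectionOnto = stdGaussian V := by
  apply Measure.ext_of_charFun
  ext t
  rw [charFun_stdGaussian, charFun_apply, integral_map (by fun_prop)
    (Measurable.aestronglyMeasurable (by fun_prop))]
  have := charFun_stdGaussian (E := F) (t : F)
  rw [charFun_apply] at this
  rw [Submodule.coe_norm, ← this]
  congr 1
  ext x
  rw [← Submodule.inner_orthogonalProjectionOnto_eq_of_mem_right]

lemma lintegral_inv_norm_sq_orthogonalProjectionOnto (V : Submodule ℝ F)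
    (hk : 2 < Module.finrank ℝ V) :
    ∫⁻ x, ENNReal.ofReal ((‖V.orthogonalProjectionOnto x‖ ^ 2)⁻¹) ∂(stdGaussian F)
      = ENNReal.ofReal (((Module.finrank ℝ V : ℝ) - 2)⁻¹) := by
  rw [← lintegral_inv_norm_sq_stdGaussian hk, ← map_orthogonalProjectionOnto_stdGaussian V,
    lintegral_map (by fun_prop) (by fun_prop)]

lemma lintegral_inner_sq_stdGaussian (u : F) :
    ∫⁻ x, ENNReal.ofReal (inner ℝ u x ^ 2) ∂(stdGaussian F) = ENNReal.ofReal (‖u‖ ^ 2) := by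
  have h := variance_dual_stdGaussian (innerSL ℝ u)
  rw [variance_of_integral_eq_zero (by fun_prop) (integral_strongDual_stdGaussian _),
    innerSL_apply_norm] at h
  rw [← h, ofReal_integral_eq_lintegral_ofReal]
  · rfl
  · exact (IsGaussian.memLp_dual (stdGaussian F) (innerSL ℝ u) 2 (by simp)).integrable_sq
  · exact .of_forall fun _ => sq_nonneg _


/-! ### Resampling one coordinate of a product measure -/

section Resampling

variable {ι : Type*} [Fintype ι] [DecidableEq ι] {X : ι → Type*} [∀ i, MeasurableSpace (X i)]
  (μ : ∀ i, Measure (X i)) [∀ i, IsProbabilityMeasure (μ i)]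

/-- Redrawing the coordinate `i` does not change a product of probability measures. -/
lemma lintegral_pi_update {f : (∀ i, X i) → ENNReal} (hf : Measurable f) (i : ι) :
    ∫⁻ x, f x ∂(Measure.pi μ)
      = ∫⁻ x, (∫⁻ y, f (Function.update x i y) ∂(μ i)) ∂(Measure.pi μ) := by
  have hg : Measurable (∫⋯∫⁻_{i}, f ∂μ) := hf.lmarginal μ
  refine (lintegral_eq_of_lmarginal_eq {i} hf hg ?_).trans ?_
  · ext x
    rw [lmarginal_singleton (μ := μ) (∫⋯∫⁻_{i}, f ∂μ)]
    simp [lmarginal_update_of_mem]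
  · rw [lmarginal_singleton]

lemma ae_pi_of_ae_update {p : (∀ i, X i) → Prop} (hp : MeasurableSet {x | p x}) (i : ι)
    (h : ∀ᵐ x ∂(Measure.pi μ), ∀ᵐ y ∂(μ i), p (Function.update x i y)) :
    ∀ᵐ x ∂(Measure.pi μ), p x := by
  rw [ae_iff, ← Set.compl_ofPred, ← lintegral_indicator_one hp.compl,
    lintegral_pi_update μ (measurable_one.indicator hp.compl) i]
  refine (lintegral_congr_ae ?_).trans lintegral_zero
  filter_upwards [h] with x hx
  refine (lintegral_congr_ae ?_).trans lintegral_zero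
  filter_upwards [hx] with y hy
  simp [hy]

end Resampling

/-! ### Dual vectors and regression coefficients -/

section DualVector

variable {κ : Type*} [Fintype κ] [DecidableEq κ] {E : Type*} [NormedAddCommGroup E]
  [InnerProductSpace ℝ E]

/-- The `j`-th vector of the basis of `span g` dual to the linearly independent family `g`, given
by the inverse of the Gram matrix. It is zero, as that inverse is, if `g` is linearly dependent. -/
noncomputable def dualVector (g : κ → E) (j : κ) : E := ∑ i, (Matrix.gram ℝ g)⁻¹ i j • g i

/-- The coefficient of `c (some j)` in the least squares regression of the response `c none` on
the family `c (some i)`, which is assumed to be linearly independent. -/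
noncomputable def regressionCoeff (c : Option κ → E) (j : κ) : ℝ :=
  inner ℝ (dualVector (fun i => c (some i)) j) (c none)

lemma inner_dualVector {g : κ → E} (hg : LinearIndependent ℝ g) (j l : κ) :
    inner ℝ (dualVector g j) (g l) = if j = l then 1 else 0 := by
  have hdet : IsUnit (Matrix.gram ℝ g).det :=
    (Matrix.det_gram_ne_zero_iff_linearIndependent.2 hg).isUnit
  have h := congrFun (congrFun (Matrix.mul_nonsing_inv (Matrix.gram ℝ g) hdet) l) j
  rw [Matrix.mul_apply, Matrix.one_apply] at h
  simp only [Matrix.gram_apply] at h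
  simp only [eq_comm (a := j), ← h, dualVector, sum_inner, real_inner_smul_left]
  exact Finset.sum_congr rfl fun i _ => by rw [mul_comm, real_inner_comm]

/-- The dual vector `q` is a multiple of the component `p` of `g j` orthogonal to the other vectors
of the family, and `⟪q, p⟫ = ⟪q, g j⟫ = 1`. -/
lemma norm_dualVector_sq [FiniteDimensional ℝ E] {g : κ → E} (hg : LinearIndependent ℝ g)
    (j : κ) :
    ‖dualVector g j‖ ^ 2 =
      (‖(Submodule.span ℝ (g '' {j}ᶜ))ᗮ.orthogonalProjectionOnto (g j)‖ ^ 2)⁻¹ := by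
  set V := Submodule.span ℝ (g '' {j}ᶜ)
  set q := dualVector g j with hq
  have hqV : q ∈ Vᗮ := by
    refine (Submodule.mem_orthogonal' V q).2 fun v hv => ?_
    induction hv using Submodule.span_induction with
    | mem x hx =>
      obtain ⟨l, hl, rfl⟩ := hx
      rw [hq, inner_dualVector hg, if_neg (Ne.symm hl)]
    | zero => simp
    | add x y _ _ hx hy => rw [inner_add_right, hx, hy, add_zero]
    | smul a x _ hx => rw [inner_smul_right, hx, mul_zero]
  have hqp : q = (Matrix.gram ℝ g)⁻¹ j j • (Vᗮ.orthogonalProjectionOnto (g j) : E) := by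
    have h1 : (Vᗮ.orthogonalProjectionOnto q : E) = q :=
      by
      rw [Submodule.coe_orthogonalProjectionOnto_apply]
      exact Submodule.starProjection_eq_self_iff.2 hqV
    rw [← h1, hq, dualVector, map_sum, AddSubmonoidClass.coe_finsetSum, Finset.sum_eq_single j]
    · simp
    · intro i _ hij
      have : g i ∈ V := Submodule.subset_span ⟨i, hij, rfl⟩
      rw [map_smul, Submodule.orthogonalProjectionOnto_apply_of_mem_orthogonal
        (Submodule.le_orthogonal_orthogonal V this), smul_zero, Submodule.coe_zero]
    · simp
  have h1 : inner ℝ q (Vᗮ.orthogonalProjectionOnto (g j) : E) = 1 := by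
    rw [← (inner_dualVector hg j j).trans (if_pos rfl), ← hq]
    exact Submodule.inner_orthogonalProjectionOnto_eq_of_mem_left ⟨q, hqV⟩ (g j)
  have h2 : ‖q‖ ^ 2 = (Matrix.gram ℝ g)⁻¹ j j := by
    rw [← real_inner_self_eq_norm_sq]
    nth_rw 2 [hqp]
    rw [inner_smul_right, h1, mul_one]
  rw [hqp, inner_smul_left, real_inner_self_eq_norm_sq] at h1
  rw [h2]
  exact eq_inv_of_mul_eq_one_left h1

/-- The normal equations determine the coefficients of a least squares approximation. -/
lemma eq_regressionCoeff {c : Option κ → E} (hc : LinearIndependent ℝ fun i => c (some i))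
    {w : κ → ℝ}
    (hw : ∀ i, inner ℝ (c (some i)) (∑ l, w l • c (some l) - c none) = 0) (j : κ) :
    w j = regressionCoeff c j := by
  have h : inner ℝ (dualVector (fun i => c (some i)) j) (∑ l, w l • c (some l) - c none) = 0 := by
    conv_lhs => rw [dualVector]
    simp [sum_inner, real_inner_smul_left, hw]
  rw [inner_sub_right, inner_sum, sub_eq_zero] at h
  rw [regressionCoeff, ← h]
  simp [inner_smul_right, inner_dualVector hc]

variable [FiniteDimensional ℝ E] [MeasurableSpace E] [BorelSpace E]

lemma measurable_dualVector (j : κ) : Measurable fun g : κ → E => dualVector g j := by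
  have hgram : Continuous fun g : κ → E => Matrix.gram ℝ g := by
    refine continuous_matrix fun i l => ?_
    simp only [Matrix.gram_apply]
    fun_prop
  have hadj : Continuous fun g : κ → E => (Matrix.gram ℝ g).adjugate := hgram.matrix_adjugate
  have hdet : Continuous fun g : κ → E => (Matrix.gram ℝ g).det := hgram.matrix_det
  simp only [dualVector, Matrix.inv_def, Ring.inverse_eq_inv', Matrix.smul_apply, smul_eq_mul]
  refine Finset.measurable_sum _ fun i _ => ?_
  exact (hdet.measurable.inv.mul (hadj.matrix_elem i j).measurable).smul (measurable_pi_apply i)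

@[fun_prop]
lemma measurable_regressionCoeff (j : κ) :
    Measurable fun c : Option κ → E => regressionCoeff c j := by
  have h : Measurable fun c : Option κ → E => dualVector (fun i => c (some i)) j :=
    (measurable_dualVector j).comp (by fun_prop)
  exact h.inner (measurable_pi_apply none)

end DualVector

/-! ### Moments of the regression coefficients of Gaussian vectors -/

section Moments

variable {E : Type*} [NormedAddCommGroup E] [InnerProductSpace ℝ E]
  [FiniteDimensional ℝ E] [MeasurableSpace E] [BorelSpace E]

lemma measurableSet_linearIndepOn {ι : Type*} [Finite ι] (s : Finset ι) :
    MeasurableSet {c : ι → E | LinearIndepOn ℝ c s} := by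
  classical
  have h : {c : ι → E | LinearIndepOn ℝ c s}
      = {c | (Matrix.gram ℝ fun i : s => c i).det ≠ 0} := by
    ext c
    exact Matrix.det_gram_ne_zero_iff_linearIndependent.symm
  rw [h]
  have hdet : Continuous fun c : ι → E => (Matrix.gram ℝ fun i : s => c i).det := by
    refine Continuous.matrix_det (continuous_matrix fun i l => ?_)
    simp only [Matrix.gram_apply]
    fun_prop
  exact (isOpen_ne_fun hdet continuous_const).measurableSet

/-- At most `finrank E` independent standard Gaussian vectors are almost surely linearly
independent: one more vector almost surely avoids the span of the previous ones. -/
lemma ae_linearIndepOn_pi_stdGaussian {ι : Type*} [Fintype ι] (s : Finset ι)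
    (hs : s.card ≤ Module.finrank ℝ E) :
    ∀ᵐ c ∂(Measure.pi fun _ : ι => stdGaussian E), LinearIndepOn ℝ c s := by
  classical
  induction s using Finset.induction_on with
  | empty => exact .of_forall fun c => by simp
  | insert a s ha ih =>
    rw [Finset.card_insert_of_notMem ha] at hs
    refine ae_pi_of_ae_update _ (measurableSet_linearIndepOn _) a ?_
    filter_upwards [ih (by omega)] with c hc
    have hV : Submodule.span ℝ (c '' s) ≠ ⊤ := by
      intro h
      have h1 := finrank_span_le_card (R := ℝ) (c '' (s : Set ι))
      rw [h, finrank_top] at h1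
      have h2 := Set.ncard_image_le (f := c) s.finite_toSet
      rw [Set.ncard_coe_finset, Set.ncard_eq_toFinset_card'] at h2
      omega
    have hnull := stdGaussian_submodule_eq_zero hV
    filter_upwards [measure_eq_zero_iff_ae_notMem.1 hnull] with y hy
    have heq : Set.EqOn (Function.update c a y) c s := fun i hi =>
      Function.update_of_ne (ne_of_mem_of_not_mem hi ha) _ _
    rw [Finset.coe_insert, linearIndepOn_insert (by simpa using ha), heq.image_eq,
      Function.update_self]
    exact ⟨hc.congr heq.symm, hy⟩

variable {κ : Type*} [Fintype κ]

lemma ae_linearIndependent_some (hκ : Fintype.card κ ≤ Module.finrank ℝ E) :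
    ∀ᵐ c ∂(Measure.pi fun _ : Option κ => stdGaussian E),
      LinearIndependent ℝ fun i : κ => c (some i) := by
  classical
  have h := ae_linearIndepOn_pi_stdGaussian (E := E)
    (Finset.univ.map (Function.Embedding.some : κ ↪ Option κ)) (by simpa using hκ)
  filter_upwards [h] with c hc
  exact LinearIndependent.comp hc
    (fun i : κ => ⟨some i, by simp⟩) fun i l h => by simpa using h

variable [DecidableEq κ]

/-- The second moment of a regression coefficient of `d + 1` independent standard Gaussian vectors
in dimension `m`. Drawing the response first leaves the squared norm of the dual vector, which is
the inverse of a chi-squared variable with `m - d + 1` degrees of freedom once all regressors but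
one are fixed. -/
lemma lintegral_regressionCoeff_sq (hκ : Fintype.card κ + 1 < Module.finrank ℝ E) (j : κ) :
    ∫⁻ c, ENNReal.ofReal (regressionCoeff c j ^ 2) ∂(Measure.pi fun _ : Option κ => stdGaussian E)
      = ENNReal.ofReal (((Module.finrank ℝ E : ℝ) - Fintype.card κ - 1)⁻¹) := by
  have hsome : Measurable fun c : Option κ → E => fun i : κ => c (some i) := by fun_prop
  have hq : Measurable fun c : Option κ → E => dualVector (fun i => c (some i)) j :=
    (measurable_dualVector j).comp hsome
  rw [lintegral_pi_update _ (by fun_prop) none]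
  have h1 (c : Option κ → E) : ∫⁻ y, ENNReal.ofReal
        (regressionCoeff (Function.update c none y) j ^ 2) ∂(stdGaussian E)
      = ENNReal.ofReal (‖dualVector (fun i => c (some i)) j‖ ^ 2) := by
    rw [← lintegral_inner_sq_stdGaussian]
    simp [regressionCoeff]
  simp_rw [h1]
  rw [lintegral_pi_update _ (by fun_prop) (some j)]
  -- The inner integral over the regressor `j` is the same constant for almost all other ones.
  trans ∫⁻ _ : Option κ → E, ENNReal.ofReal (((Module.finrank ℝ E : ℝ) - Fintype.card κ - 1)⁻¹)
    ∂(Measure.pi fun _ : Option κ => stdGaussian E)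
  swap
  · simp
  refine lintegral_congr_ae ?_
  filter_upwards [ae_linearIndependent_some (κ := κ) (E := E) (by omega)] with c hc
  have hupd (y : E) : (fun i : κ => Function.update c (some j) y (some i))
      = Function.update (fun i : κ => c (some i)) j y := by
    ext i
    by_cases h : i = j
    · subst h; simp
    · simp [h]
  simp_rw [hupd]
  set g : κ → E := fun i => c (some i) with hg
  set V := Submodule.span ℝ (g '' {j}ᶜ) with hV
  have hVdim : Module.finrank ℝ V + 1 = Fintype.card κ := by
    have h2 := finrank_span_eq_card (hc.comp (fun i : ({j}ᶜ : Set κ) => (i : κ))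
      Subtype.coe_injective)
    have h3 : Set.range (g ∘ fun i : ({j}ᶜ : Set κ) => (i : κ)) = g '' {j}ᶜ := by
      rw [Set.range_comp, Subtype.range_coe]
    rw [h3] at h2
    rw [hV, h2]
    have h4 := Fintype.card_compl_set ({j} : Set κ)
    have h5 : 0 < Fintype.card κ := Fintype.card_pos_iff.2 ⟨j⟩
    simp only [Set.card_singleton] at h4
    omega
  have hVperp := V.finrank_add_finrank_orthogonal
  have hVtop : V ≠ ⊤ := by
    intro h
    rw [h, finrank_top] at hVdim
    omega
  rw [show (Module.finrank ℝ E : ℝ) - Fintype.card κ - 1 = (Module.finrank ℝ Vᗮ : ℝ) - 2 by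
    rw [← hVperp, ← hVdim]; push_cast; ring,
    ← lintegral_inv_norm_sq_orthogonalProjectionOnto Vᗮ (by omega)]
  refine lintegral_congr_ae ?_
  filter_upwards [measure_eq_zero_iff_ae_notMem.1 (stdGaussian_submodule_eq_zero hVtop)]
    with y hy
  have heq : Set.EqOn (Function.update g j y) g {j}ᶜ := fun i hi => Function.update_of_ne hi _ _
  have hli : LinearIndependent ℝ (Function.update g j y) := by
    rw [← linearIndepOn_univ_iff, ← Set.insert_sdiff_self_of_mem (Set.mem_univ j),
      ← Set.compl_eq_univ_sdiff, linearIndepOn_insert (by simp), heq.image_eq,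
      Function.update_self]
    exact ⟨((linearIndepOn_univ_iff.2 hc).mono (Set.subset_univ _)).congr heq.symm, hy⟩
  rw [norm_dualVector_sq hli, heq.image_eq, Function.update_self]

lemma memLp_regressionCoeff (hκ : Fintype.card κ + 1 < Module.finrank ℝ E) (j : κ) :
    MemLp (fun c : Option κ → E => regressionCoeff c j) 2
      (Measure.pi fun _ : Option κ => stdGaussian E) := by
  have hm : Measurable fun c : Option κ → E => regressionCoeff c j := by fun_prop
  rw [memLp_two_iff_integrable_sq hm.aestronglyMeasurable]
  refine ⟨(hm.pow_const 2).aestronglyMeasurable, ?_⟩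
  rw [hasFiniteIntegral_iff_ofReal (.of_forall fun _ => sq_nonneg _),
    lintegral_regressionCoeff_sq hκ]
  exact ENNReal.ofReal_lt_top

lemma integral_regressionCoeff_sq (hκ : Fintype.card κ + 1 < Module.finrank ℝ E) (j : κ) :
    ∫ c, regressionCoeff c j ^ 2 ∂(Measure.pi fun _ : Option κ => stdGaussian E)
      = ((Module.finrank ℝ E : ℝ) - Fintype.card κ - 1)⁻¹ := by
  have hm : Measurable fun c : Option κ → E => regressionCoeff c j := by fun_prop
  rw [integral_eq_lintegral_of_nonneg_ae (.of_forall fun _ => sq_nonneg _)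
    (hm.pow_const 2).aestronglyMeasurable, lintegral_regressionCoeff_sq hκ, ENNReal.toReal_ofReal]
  have : (Fintype.card κ : ℝ) + 1 < Module.finrank ℝ E := by exact_mod_cast hκ
  exact inv_nonneg.2 (by linarith)

/-- The regression coefficients are odd in the response, and the law of the response is
symmetric. -/
lemma integral_regressionCoeff (j : κ) :
    ∫ c, regressionCoeff c j ∂(Measure.pi fun _ : Option κ => stdGaussian E) = 0 := by
  set f : Option κ → E → E := fun i => Option.casesOn i (fun y => -y) (fun _ y => y) with hf
  have hmp : MeasurePreserving (fun (c : Option κ → E) i => f i (c i))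
      (Measure.pi fun _ : Option κ => stdGaussian E)
      (Measure.pi fun _ : Option κ => stdGaussian E) := by
    refine measurePreserving_pi _ _ fun i => ?_
    cases i with
    | none =>
      exact ⟨measurable_neg, stdGaussian_map (LinearIsometryEquiv.neg ℝ)⟩
    | some i => exact MeasurePreserving.id _
  have hm : Measurable fun c : Option κ → E => regressionCoeff c j := by fun_prop
  have h := integral_map (μ := Measure.pi fun _ => stdGaussian E) hmp.measurable.aemeasurable
    hm.aestronglyMeasurable (f := fun c : Option κ → E => regressionCoeff c j)
  rw [hmp.map_eq] at h
  have hneg (c : Option κ → E) :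
      regressionCoeff (fun i => f i (c i)) j = -regressionCoeff c j := by
    simp [regressionCoeff, hf]
  simp_rw [hneg, integral_neg] at h
  linarith

end Moments


/-! ### Least squares solutions -/

lemma lsObjective_eq_dotProduct {n d : ℕ} (A : Matrix (Fin n) (Fin d) ℝ) (b : Fin n → ℝ)
    (x : Fin d → ℝ) :
    lsObjective A b x = (A.mulVec x - b) ⬝ᵥ (A.mulVec x - b) := by
  rw [lsObjective, EuclideanSpace.real_norm_sq_eq]
  exact Finset.sum_congr rfl fun i _ => sq _

lemma lsObjective_add {n d : ℕ} (A : Matrix (Fin n) (Fin d) ℝ) (b : Fin n → ℝ)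
    (x z : Fin d → ℝ) :
    lsObjective A b (x + z) = lsObjective A b x + 2 * ((A.mulVec x - b) ⬝ᵥ A.mulVec z)
      + A.mulVec z ⬝ᵥ A.mulVec z := by
  rw [lsObjective_eq_dotProduct, lsObjective_eq_dotProduct, Matrix.mulVec_add, add_sub_right_comm,
    add_dotProduct, dotProduct_add, dotProduct_add, dotProduct_comm (A.mulVec z) (_ - b)]
  ring

/-- The normal equations. -/
lemma isLeastSquaresSolution_iff {n d : ℕ} {A : Matrix (Fin n) (Fin d) ℝ} {b : Fin n → ℝ}
    {x : Fin d → ℝ} :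
    IsLeastSquaresSolution A b x ↔ ∀ z, (A.mulVec x - b) ⬝ᵥ A.mulVec z = 0 := by
  constructor
  · intro h z
    set D := (A.mulVec x - b) ⬝ᵥ A.mulVec z with hD
    set Q := A.mulVec z ⬝ᵥ A.mulVec z with hQ
    have hQ0 : 0 ≤ Q := Finset.sum_nonneg fun i _ => mul_self_nonneg _
    have key (t : ℝ) : 0 ≤ 2 * (t * D) + t * (t * Q) := by
      have h1 := h (x + t • z)
      rw [lsObjective_add, Matrix.mulVec_smul, dotProduct_smul, dotProduct_smul, smul_dotProduct]
        at h1
      simp only [smul_eq_mul, ← hD, ← hQ] at h1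
      linarith
    -- A step against the gradient, of a length for which the linear term dominates.
    have h2 := key (-(D / (Q + 1)))
    have h3 : 2 * (-(D / (Q + 1)) * D) + -(D / (Q + 1)) * (-(D / (Q + 1)) * Q)
        = -(D ^ 2 * (Q + 2) / (Q + 1) ^ 2) := by
      field_simp
      ring
    rw [h3] at h2
    by_contra hne
    have : 0 < D ^ 2 * (Q + 2) / (Q + 1) ^ 2 := by positivity
    linarith
  · intro h z
    have h1 := lsObjective_add A b x (z - x)
    rw [h, add_sub_cancel] at h1
    have h2 : 0 ≤ A.mulVec (z - x) ⬝ᵥ A.mulVec (z - x) :=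
      Finset.sum_nonneg fun i _ => mul_self_nonneg _
    linarith

/-! ### Gaussian sketches of orthonormal vectors -/

/-- The sketches `√m S vₐ` of the vectors `vₐ`, scaled to have entries of variance one for
orthonormal `vₐ`. -/
noncomputable def sketchedVectors {α : Type*} {m n : ℕ} (v : α → EuclideanSpace ℝ (Fin n))
    (S : Matrix (Fin m) (Fin n) ℝ) (a : α) : EuclideanSpace ℝ (Fin m) :=
  WithLp.toLp 2 (√m • S.mulVec (v a).ofLp)

lemma sketchedVectors_apply {α : Type*} {m n : ℕ} (v : α → EuclideanSpace ℝ (Fin n))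
    (S : Matrix (Fin m) (Fin n) ℝ) (a : α) (i : Fin m) :
    sketchedVectors v S a i = ∑ j, √m * v a j * S i j := by
  simp only [sketchedVectors, Matrix.mulVec, dotProduct, Pi.smul_apply, smul_eq_mul,
    Finset.mul_sum]
  exact Finset.sum_congr rfl fun j _ => by ring

section SketchLaw

variable {Ω : Type*} [MeasurableSpace Ω] {P : Measure Ω} {q m n : ℕ}
  {S : Fin q → Ω → Matrix (Fin m) (Fin n) ℝ} {α : Type*}
  {v : α → EuclideanSpace ℝ (Fin n)}

lemma IsIIDGaussianSketches.hasGaussianLaw (hS : IsIIDGaussianSketches P S) :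
    HasGaussianLaw (fun ω (p : Fin q × Fin m × Fin n) => S p.1 ω p.2.1 p.2.2) P :=
  hS.indep.hasGaussianLaw fun p => (hS.hasLaw p.1 p.2.1 p.2.2).hasGaussianLaw

lemma IsIIDGaussianSketches.hasGaussianLaw_sketchedVectors [Finite α]
    (hS : IsIIDGaussianSketches P S) :
    HasGaussianLaw (fun ω (k : Fin q) (p : α × Fin m) => sketchedVectors v (S k ω) p.1 p.2) P := by
  have := Fintype.ofFinite α
  let L : (Fin q × Fin m × Fin n → ℝ) →L[ℝ] (Fin q → α × Fin m → ℝ) :=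
    ContinuousLinearMap.pi fun k => ContinuousLinearMap.pi fun p =>
      ∑ j, (√m * v p.1 j) • ContinuousLinearMap.proj (R := ℝ) (k, p.2, j)
  have h := hS.hasGaussianLaw.map_fun L
  convert! h using 4
  simp [L, sketchedVectors_apply]

open Classical in
lemma IsIIDGaussianSketches.covariance_sketchedVectors (hm : 0 < m)
    (hS : IsIIDGaussianSketches P S) (hv : Orthonormal ℝ v) (k k' : Fin q) (a a' : α)
    (i i' : Fin m) :
    cov[fun ω => sketchedVectors v (S k ω) a i, fun ω => sketchedVectors v (S k' ω) a' i'; P]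
      = if (k, a, i) = (k', a', i') then 1 else 0 := by
  have hmem (p : Fin q × Fin m × Fin n) : MemLp (fun ω => S p.1 ω p.2.1 p.2.2) 2 P :=
    (hS.hasLaw p.1 p.2.1 p.2.2).hasGaussianLaw.memLp_two
  have hcov (p p' : Fin q × Fin m × Fin n) :
      cov[fun ω => S p.1 ω p.2.1 p.2.2, fun ω => S p'.1 ω p'.2.1 p'.2.2; P]
        = if p = p' then (m : ℝ)⁻¹ else 0 := by
    split_ifs with h
    · subst h
      rw [covariance_self (hmem p).aemeasurable, (hS.hasLaw p.1 p.2.1 p.2.2).variance_eq,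
        variance_id_gaussianReal]
      simp
    · exact (hS.indep.indepFun h).covariance_eq_zero (hmem p) (hmem p')
  have hexp (k : Fin q) (a : α) (i : Fin m) :
      (fun ω => sketchedVectors v (S k ω) a i) = fun ω => ∑ j, √m * v a j * S k ω i j :=
    funext fun ω => sketchedVectors_apply v (S k ω) a i
  have := hS.indep.isProbabilityMeasure
  rw [hexp, hexp, covariance_fun_sum_fun_sum (fun j => (hmem (k, i, j)).const_mul _)
    (fun j => (hmem (k', i', j)).const_mul _)]
  have hterm (j j' : Fin n) :
      cov[fun ω => √m * v a j * S k ω i j, fun ω => √m * v a' j' * S k' ω i' j'; P]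
        = if (k, i) = (k', i') then (if j = j' then v a j * v a' j' else 0) else 0 := by
    rw [covariance_const_mul_left, covariance_const_mul_right, hcov (k, i, j) (k', i', j')]
    have h1 : √(m : ℝ) * √m = m := Real.mul_self_sqrt (by positivity)
    have h2 : (m : ℝ) ≠ 0 := by positivity
    by_cases hk : k = k' <;> by_cases hi : i = i' <;> by_cases hj : j = j' <;>
      simp only [hk, hi, hj, Prod.mk.injEq, and_true, and_false, if_true,
        if_false, mul_zero]
    rw [show √m * v a j' * (√m * v a' j' * (m : ℝ)⁻¹)
      = (√m * √m) * (m : ℝ)⁻¹ * (v a j' * v a' j') by ring, h1, mul_inv_cancel₀ h2, one_mul]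
  simp_rw [hterm]
  have hin : ∑ j, v a j * v a' j = if a = a' then 1 else 0 := by
    rw [← orthonormal_iff_ite.1 hv a a', PiLp.inner_apply]
    exact Finset.sum_congr rfl fun j _ => by simp [mul_comm]
  by_cases hk : k = k' <;> by_cases hi : i = i' <;> simp [hk, hi, hin]

/-- The sketches of different workers are independent. -/
lemma IsIIDGaussianSketches.iIndepFun_sketchedVectors [Finite α] (hm : 0 < m)
    (hS : IsIIDGaussianSketches P S) (hv : Orthonormal ℝ v) :
    iIndepFun (fun k ω => sketchedVectors v (S k ω)) P := by
  classical
  have h := (hS.hasGaussianLaw_sketchedVectors (v := v)).iIndepFun_of_covariance_eval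
    (X := fun k (p : α × Fin m) ω => sketchedVectors v (S k ω) p.1 p.2) fun k k' hk p p' => by
      rw [hS.covariance_sketchedVectors hm hv, if_neg (fun h => hk (Prod.ext_iff.1 h).1)]
  exact h.comp (fun _ (y : α × Fin m → ℝ) a => WithLp.toLp 2 fun i => y (a, i))
    fun _ => by fun_prop

/-- The scaled Gaussian sketches of orthonormal vectors are independent standard Gaussian
vectors. -/
lemma IsIIDGaussianSketches.hasLaw_sketchedVectors [Fintype α] (hm : 0 < m)
    (hS : IsIIDGaussianSketches P S) (hv : Orthonormal ℝ v) (k : Fin q) :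
    HasLaw (fun ω => sketchedVectors v (S k ω))
      (Measure.pi fun _ : α => stdGaussian (EuclideanSpace ℝ (Fin m))) P := by
  classical
  have hP := hS.indep.isProbabilityMeasure
  have hG := (hS.hasGaussianLaw_sketchedVectors (v := v)).eval k
  have hG2 : HasGaussianLaw (fun ω (a : α) (i : Fin m) => sketchedVectors v (S k ω) a i) P := by
    let L : (α × Fin m → ℝ) →L[ℝ] (α → Fin m → ℝ) :=
      ContinuousLinearMap.pi fun a => ContinuousLinearMap.pi fun i =>
        ContinuousLinearMap.proj (R := ℝ) (a, i)
    exact hG.map_fun L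
  have hindα : iIndepFun (fun a ω (i : Fin m) => sketchedVectors v (S k ω) a i) P :=
    hG2.iIndepFun_of_covariance_eval
      (X := fun a i ω => sketchedVectors v (S k ω) a i) fun a a' ha i i' => by
        rw [hS.covariance_sketchedVectors hm hv, if_neg (by simp [ha])]
  have hlaw (a : α) : P.map (fun ω => sketchedVectors v (S k ω) a)
      = stdGaussian (EuclideanSpace ℝ (Fin m)) := by
    have hGa := hG2.eval a
    have hindm : iIndepFun (fun i ω => sketchedVectors v (S k ω) a i) P :=
      hGa.iIndepFun_of_covariance_eq_zero fun i i' hi => by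
        rw [hS.covariance_sketchedVectors hm hv, if_neg (by simp [hi])]
    have h1 (i : Fin m) : P.map (fun ω => sketchedVectors v (S k ω) a i) = gaussianReal 0 1 := by
      rw [(hGa.eval i).map_eq_gaussianReal]
      congr 1
      · have hmem (j : Fin n) : Integrable (fun ω => S k ω i j) P :=
          (hS.hasLaw k i j).hasGaussianLaw.integrable
        simp only [sketchedVectors_apply]
        rw [integral_finsetSum _ fun j _ => (hmem j).const_mul _]
        simp_rw [integral_const_mul, (hS.hasLaw k i _).integral_eq]
        simp
      · rw [← covariance_self (hGa.eval i).aemeasurable, hS.covariance_sketchedVectors hm hv]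
        simp
    have h2 := hindm.map_fun_eq_pi_map fun i => (hGa.eval i).aemeasurable
    simp_rw [h1] at h2
    rw [← map_pi_eq_stdGaussian, ← h2, AEMeasurable.map_map_of_aemeasurable (by fun_prop)
      hGa.aemeasurable]
    rfl
  have hmeas (a : α) : AEMeasurable (fun ω => sketchedVectors v (S k ω) a) P :=
    (by fun_prop : Measurable (WithLp.toLp 2 : (Fin m → ℝ) → _)).comp_aemeasurable
      (hG2.eval a).aemeasurable
  have hindα' : iIndepFun (fun a ω => sketchedVectors v (S k ω) a) P :=
    hindα.comp (fun _ => WithLp.toLp 2) fun _ => by fun_prop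
  refine ⟨aemeasurable_pi_lambda _ hmeas, ?_⟩
  rw [hindα'.map_fun_eq_pi_map hmeas]
  simp_rw [hlaw]

end SketchLaw


/-! ### The error of a sketched solution in residual coordinates -/

/-- An orthonormal family `v` such that the vectors `v (some i)` form a basis of the column space
of `A` and `v none` is the normalized residual of the least squares solution `xstar`. -/
structure IsResidualFrame {n d : ℕ} (A : Matrix (Fin n) (Fin d) ℝ) (b : Fin n → ℝ)
    (xstar : Fin d → ℝ) (v : Option (Fin d) → EuclideanSpace ℝ (Fin n)) : Prop where
  orthonormal : Orthonormal ℝ v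
  none_eq : v none = (√(lsObjective A b xstar))⁻¹ • WithLp.toLp 2 (b - A.mulVec xstar)
  some_mem : ∀ i, ∃ z, v (some i) = WithLp.toLp 2 (A.mulVec z)
  sum_eq : ∀ x, ∑ i, inner ℝ (v (some i)) (WithLp.toLp 2 (A.mulVec x)) • v (some i)
    = WithLp.toLp 2 (A.mulVec x)

/-- The coordinates of the error vector `A (x - xstar)` in a residual frame, relative to the norm
of the residual. -/
noncomputable def errorCoord {n d : ℕ} (A : Matrix (Fin n) (Fin d) ℝ) (b : Fin n → ℝ)
    (xstar : Fin d → ℝ) (v : Option (Fin d) → EuclideanSpace ℝ (Fin n)) (x : Fin d → ℝ)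
    (i : Fin d) : ℝ :=
  (√(lsObjective A b xstar))⁻¹ * inner ℝ (v (some i)) (WithLp.toLp 2 (A.mulVec (x - xstar)))

section Frame

variable {n d : ℕ} {A : Matrix (Fin n) (Fin d) ℝ} {b : Fin n → ℝ} {xstar : Fin d → ℝ}

lemma exists_isResidualFrame (hA : A.rank = d) (hx : IsLeastSquaresSolution A b xstar)
    (hpos : 0 < lsObjective A b xstar) : ∃ v, IsResidualFrame A b xstar v := by
  let T : (Fin d → ℝ) →ₗ[ℝ] EuclideanSpace ℝ (Fin n) :=
    (WithLp.linearEquiv 2 ℝ (Fin n → ℝ)).symm.toLinearMap ∘ₗ A.mulVecLin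
  have hT (x : Fin d → ℝ) : T x = WithLp.toLp 2 (A.mulVec x) := rfl
  have hdim : Module.finrank ℝ (LinearMap.range T) = d := by
    rw [LinearMap.range_comp, LinearEquiv.finrank_map_eq]
    exact hA
  let u : OrthonormalBasis (Fin d) ℝ (LinearMap.range T) :=
    (stdOrthonormalBasis ℝ _).reindex (finCongr hdim)
  set ρ := √(lsObjective A b xstar) with hρ
  have hρ0 : 0 < ρ := Real.sqrt_pos.2 hpos
  have hnorm : ‖WithLp.toLp 2 (b - A.mulVec xstar)‖ = ρ := by
    rw [hρ, lsObjective, Real.sqrt_sq (norm_nonneg _), ← neg_sub, WithLp.toLp_neg, norm_neg]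
  have horth (i : Fin d) :
      inner ℝ (u i : EuclideanSpace ℝ (Fin n)) (WithLp.toLp 2 (b - A.mulVec xstar)) = 0 := by
    obtain ⟨z, hz⟩ := (u i).2
    have h := isLeastSquaresSolution_iff.1 hx z
    rw [← hz, hT, EuclideanSpace.inner_toLp_toLp, ← neg_sub, neg_dotProduct, neg_eq_zero]
    simpa using h
  refine ⟨fun o => o.elim (ρ⁻¹ • WithLp.toLp 2 (b - A.mulVec xstar)) fun i => u i,
    ⟨?_, ?_⟩, rfl, fun i => ?_, fun x => ?_⟩
  · rintro (_ | i)
    · change ‖ρ⁻¹ • _‖ = 1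
      rw [norm_smul, hnorm, norm_inv, Real.norm_of_nonneg hρ0.le, inv_mul_cancel₀ hρ0.ne']
    · exact u.orthonormal.1 i
  · rintro (_ | i) (_ | j) hij
    · exact absurd rfl hij
    · change inner ℝ (ρ⁻¹ • _) (u j : EuclideanSpace ℝ (Fin n)) = 0
      rw [inner_smul_left, real_inner_comm, horth, mul_zero]
    · change inner ℝ (u i : EuclideanSpace ℝ (Fin n)) (ρ⁻¹ • _) = 0
      rw [inner_smul_right, horth, mul_zero]
    · exact u.orthonormal.2 fun h => hij (congrArg some h)
  · obtain ⟨z, hz⟩ := (u i).2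
    exact ⟨z, hz.symm⟩
  · have h := congrArg (Subtype.val) (u.sum_repr' ⟨T x, LinearMap.mem_range_self T x⟩)
    rw [AddSubmonoidClass.coe_finsetSum] at h
    exact h

variable {v : Option (Fin d) → EuclideanSpace ℝ (Fin n)}

/-- The excess of the objective is the squared norm of the error vector. -/
lemma IsResidualFrame.lsObjective_eq (hv : IsResidualFrame A b xstar v)
    (hx : IsLeastSquaresSolution A b xstar) (hpos : 0 < lsObjective A b xstar) (x : Fin d → ℝ) :
    lsObjective A b x = lsObjective A b xstar
      + lsObjective A b xstar * ∑ i, errorCoord A b xstar v x i ^ 2 := by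
  have h1 := lsObjective_add A b xstar (x - xstar)
  rw [add_sub_cancel, isLeastSquaresSolution_iff.1 hx, mul_zero, add_zero] at h1
  rw [h1]
  congr 1
  set e := A.mulVec (x - xstar) with he
  have h2 : e ⬝ᵥ e = ∑ i, inner ℝ (v (some i)) (WithLp.toLp 2 e) ^ 2 := by
    have h3 : e ⬝ᵥ e = inner ℝ (WithLp.toLp 2 e) (WithLp.toLp 2 e) := by
      rw [EuclideanSpace.inner_toLp_toLp]; simp
    rw [h3]
    nth_rw 1 [← hv.sum_eq (x - xstar)]
    rw [sum_inner]
    exact Finset.sum_congr rfl fun i _ => by rw [real_inner_smul_left, sq]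
  simp only [errorCoord, mul_pow, inv_pow, Real.sq_sqrt hpos.le, ← he]
  rw [← Finset.mul_sum, ← h2, mul_inv_cancel_left₀ hpos.ne']

/-- The error coordinates of a solution of the sketched problem are the regression coefficients of
the sketched residual on the sketched basis of the column space. -/
lemma IsResidualFrame.errorCoord_eq_regressionCoeff {m : ℕ} (hv : IsResidualFrame A b xstar v)
    {S : Matrix (Fin m) (Fin n) ℝ} {x : Fin d → ℝ}
    (hx : IsLeastSquaresSolution (S * A) (S.mulVec b) x)
    (hli : LinearIndependent ℝ fun i => sketchedVectors v S (some i)) (i : Fin d) :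
    errorCoord A b xstar v x i = regressionCoeff (sketchedVectors v S) i := by
  refine eq_regressionCoeff hli (fun l => ?_) i
  set ρ := √(lsObjective A b xstar) with hρ
  let L : EuclideanSpace ℝ (Fin n) →ₗ[ℝ] EuclideanSpace ℝ (Fin m) :=
    √(m : ℝ) • ((WithLp.linearEquiv 2 ℝ (Fin m → ℝ)).symm.toLinearMap ∘ₗ S.mulVecLin ∘ₗ
      (WithLp.linearEquiv 2 ℝ (Fin n → ℝ)).toLinearMap)
  have hL (o : Option (Fin d)) : sketchedVectors v S o = L (v o) := rfl
  have hres : ∑ l, errorCoord A b xstar v x l • v (some l) - v none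
      = ρ⁻¹ • WithLp.toLp 2 (A.mulVec x - b) := by
    simp_rw [errorCoord, mul_smul, ← Finset.smul_sum]
    rw [hv.sum_eq, hv.none_eq, ← smul_sub, ← WithLp.toLp_sub, Matrix.mulVec_sub]
    congr 2
    abel
  obtain ⟨z, hz⟩ := hv.some_mem l
  simp_rw [hL, ← map_smul]
  rw [← map_sum, ← map_sub, hres, hz]
  have hLt (y : Fin n → ℝ) : L (WithLp.toLp 2 y) = √(m : ℝ) • WithLp.toLp 2 (S.mulVec y) := rfl
  have h := isLeastSquaresSolution_iff.1 hx z
  rw [← Matrix.mulVec_mulVec, ← Matrix.mulVec_mulVec, ← Matrix.mulVec_sub] at h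
  rw [map_smul, hLt, hLt, inner_smul_right, inner_smul_right, inner_smul_left,
    EuclideanSpace.inner_toLp_toLp, star_trivial, h]
  simp

lemma errorCoord_vectorAverage {q : ℕ} (hq : 0 < q) (x : Fin q → Fin d → ℝ) (i : Fin d) :
    errorCoord A b xstar v (vectorAverage x) i
      = 1 / (q : ℝ) * ∑ k, errorCoord A b xstar v (x k) i := by
  have hq' : (q : ℝ) ≠ 0 := by positivity
  have h : vectorAverage x - xstar = (1 / (q : ℝ)) • ∑ k, (x k - xstar) := by
    rw [Finset.sum_sub_distrib, smul_sub, vectorAverage, Finset.sum_const, Finset.card_univ,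
      Fintype.card_fin, ← Nat.cast_smul_eq_nsmul ℝ, smul_smul, one_div_mul_cancel hq', one_smul]
  simp_rw [errorCoord, h, Matrix.mulVec_smul, Matrix.mulVec_sum, WithLp.toLp_smul, WithLp.toLp_sum,
    inner_smul_right, inner_sum]
  rw [← Finset.mul_sum, mul_left_comm]

end Frame

/-! ### The error of the averaged solution -/

section Average

variable {Ω : Type*} [MeasurableSpace Ω] {P : Measure Ω} [IsProbabilityMeasure P] {q m n d : ℕ}
  {S : Fin q → Ω → Matrix (Fin m) (Fin n) ℝ} {v : Option (Fin d) → EuclideanSpace ℝ (Fin n)}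

/-- The error of an average of `q` independent centred coefficients is `1 / q` times the error of
each. -/
lemma IsIIDGaussianSketches.integral_average_regressionCoeff_sq (hm : d + 1 < m) (hq : 0 < q)
    (hS : IsIIDGaussianSketches P S) (hv : Orthonormal ℝ v) (i : Fin d) :
    Integrable (fun ω => (1 / (q : ℝ) * ∑ k, regressionCoeff (sketchedVectors v (S k ω)) i) ^ 2) P
    ∧ ∫ ω, (1 / (q : ℝ) * ∑ k, regressionCoeff (sketchedVectors v (S k ω)) i) ^ 2 ∂P
      = 1 / (q : ℝ) * (1 / ((m : ℝ) - d - 1)) := by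
  have hlaw (k : Fin q) := hS.hasLaw_sketchedVectors (by omega) hv k
  have hκ : Fintype.card (Fin d) + 1 < Module.finrank ℝ (EuclideanSpace ℝ (Fin m)) := by
    simpa using hm
  have hmeas : Measurable fun c : Option (Fin d) → EuclideanSpace ℝ (Fin m) =>
    regressionCoeff c i := by fun_prop
  set X : Fin q → Ω → ℝ := fun k ω => regressionCoeff (sketchedVectors v (S k ω)) i with hX
  have hXm (k : Fin q) : MemLp (X k) 2 P := by
    have h := memLp_regressionCoeff (E := EuclideanSpace ℝ (Fin m)) hκ i
    rw [← (hlaw k).map_eq] at h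
    exact (memLp_map_measure_iff hmeas.aestronglyMeasurable (hlaw k).aemeasurable).1 h
  have hX0 (k : Fin q) : ∫ ω, X k ω ∂P = 0 := by
    have h := integral_regressionCoeff (E := EuclideanSpace ℝ (Fin m)) i
    rw [← (hlaw k).map_eq, integral_map (hlaw k).aemeasurable hmeas.aestronglyMeasurable] at h
    exact h
  have hX2 (k : Fin q) : Var[X k; P] = 1 / ((m : ℝ) - d - 1) := by
    have h := integral_regressionCoeff_sq (E := EuclideanSpace ℝ (Fin m)) hκ i
    rw [← (hlaw k).map_eq, integral_map (hlaw k).aemeasurable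
      (hmeas.pow_const 2).aestronglyMeasurable] at h
    rw [variance_of_integral_eq_zero (hXm k).aemeasurable (hX0 k), one_div]
    simpa using h
  have hind : iIndepFun X P :=
    (hS.iIndepFun_sketchedVectors (by omega) hv).comp (fun _ c => regressionCoeff c i)
      fun _ => hmeas
  have hsum : MemLp (fun ω => ∑ k, X k ω) 2 P := memLp_finsetSum _ fun k _ => hXm k
  have hvar : ∫ ω, (∑ k, X k ω) ^ 2 ∂P = q * (1 / ((m : ℝ) - d - 1)) := by
    have h0 : ∫ ω, (∑ k, X k ω) ∂P = 0 := by
      rw [integral_finsetSum _ fun k _ => (hXm k).integrable one_le_two]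
      simp [hX0]
    rw [← variance_of_integral_eq_zero hsum.aemeasurable h0]
    have h := IndepFun.variance_sum (s := Finset.univ) (fun k _ => hXm k)
      (fun k _ l _ hkl => hind.indepFun hkl)
    simp only [hX2, Finset.sum_const, Finset.card_univ, Fintype.card_fin, nsmul_eq_mul] at h
    rw [← h]
    congr 1
    ext ω
    simp
  refine ⟨(hsum.const_mul _).integrable_sq, ?_⟩
  simp_rw [mul_pow]
  rw [integral_const_mul, hvar]
  have hq' : (q : ℝ) ≠ 0 := by positivity
  field_simp

/-- Markov's inequality, as a lower bound for the probability of a small value. -/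
lemma one_sub_integral_div_le_measureReal {G : Ω → ℝ} (hG : Integrable G P) (hG0 : 0 ≤ G) {ε : ℝ}
    (hε : 0 < ε) : 1 - (∫ ω, G ω ∂P) / ε ≤ P.real {ω | G ω ≤ ε} := by
  have h1 := mul_meas_ge_le_integral_of_nonneg (.of_forall hG0) hG ε
  have h2 : P.real Set.univ ≤ P.real {ω | G ω ≤ ε} + P.real {ω | ε ≤ G ω} :=
    (measureReal_mono fun ω _ => le_total (G ω) ε).trans (measureReal_union_le _ _)
  rw [probReal_univ] at h2
  have h3 : P.real {ω | ε ≤ G ω} ≤ (∫ ω, G ω ∂P) / ε := by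
    rw [le_div_iff₀ hε, mul_comm]
    exact h1
  linarith

theorem error_of_averaged_solution (A : Matrix (Fin n) (Fin d) ℝ) (b : Fin n → ℝ)
    (xstar : Fin d → ℝ) (xhat : Fin q → Ω → Fin d → ℝ) (hA : A.rank = d) (hm : d + 1 < m)
    (hq : 0 < q) (hx : IsLeastSquaresSolution A b xstar) (hpos : 0 < lsObjective A b xstar)
    (hS : IsIIDGaussianSketches P S)
    (hxhat : ∀ k, ∀ᵐ ω ∂P,
      IsLeastSquaresSolution (S k ω * A) ((S k ω).mulVec b) (xhat k ω)) :
    Integrable (fun ω => lsObjective A b (vectorAverage fun k => xhat k ω)) P ∧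
      ((∫ ω, lsObjective A b (vectorAverage fun k => xhat k ω) ∂P) - lsObjective A b xstar) /
          lsObjective A b xstar = 1 / (q : ℝ) * ((d : ℝ) / ((m : ℝ) - (d : ℝ) - 1)) ∧
      ∀ ε : ℝ, 0 < ε →
        1 - 1 / ((q : ℝ) * ε) * ((d : ℝ) / ((m : ℝ) - (d : ℝ) - 1)) ≤
          P.real {ω | (lsObjective A b (vectorAverage fun k => xhat k ω) -
            lsObjective A b xstar) / lsObjective A b xstar ≤ ε} := by
  obtain ⟨v, hv⟩ := exists_isResidualFrame hA hx hpos
  set f₀ := lsObjective A b xstar with hf₀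
  set G : Ω → ℝ := fun ω =>
    ∑ i : Fin d, (1 / (q : ℝ) * ∑ k, regressionCoeff (sketchedVectors v (S k ω)) i) ^ 2 with hG
  have hG0 : 0 ≤ G := fun ω => Finset.sum_nonneg fun i _ => sq_nonneg _
  have hmean (i : Fin d) := hS.integral_average_regressionCoeff_sq hm hq hv.orthonormal i
  have hGint : Integrable G P := integrable_finsetSum _ fun i _ => (hmean i).1
  have hGmean : ∫ ω, G ω ∂P = 1 / (q : ℝ) * ((d : ℝ) / ((m : ℝ) - (d : ℝ) - 1)) := by
    rw [integral_finsetSum _ fun i _ => (hmean i).1]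
    simp_rw [(hmean _).2]
    rw [Finset.sum_const, Finset.card_univ, Fintype.card_fin, nsmul_eq_mul]
    ring
  have hae : (fun ω => lsObjective A b (vectorAverage fun k => xhat k ω))
      =ᵐ[P] fun ω => f₀ + f₀ * G ω := by
    have hli (k : Fin q) : ∀ᵐ ω ∂P,
        LinearIndependent ℝ fun i => sketchedVectors v (S k ω) (some i) := by
      have hlaw := hS.hasLaw_sketchedVectors (by omega) hv.orthonormal k
      have h := ae_linearIndependent_some (κ := Fin d) (E := EuclideanSpace ℝ (Fin m))
        (by simp; omega)
      rw [← hlaw.map_eq] at h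
      exact ae_of_ae_map hlaw.aemeasurable h
    filter_upwards [ae_all_iff.2 hli, ae_all_iff.2 hxhat] with ω h1 h2
    rw [hv.lsObjective_eq hx hpos]
    simp_rw [errorCoord_vectorAverage hq,
      fun k i => hv.errorCoord_eq_regressionCoeff (h2 k) (h1 k) i]
    rfl
  refine ⟨((integrable_const f₀).add (hGint.const_mul f₀)).congr hae.symm, ?_, fun ε hε => ?_⟩
  · rw [integral_congr_ae hae, integral_add (integrable_const _) (hGint.const_mul _),
      integral_const_mul, hGmean, integral_const, probReal_univ, one_smul, add_sub_cancel_left,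
      mul_div_cancel_left₀ _ hpos.ne']
  · have h1 := one_sub_integral_div_le_measureReal hGint hG0 hε
    have h2 : P.real {ω | (lsObjective A b (vectorAverage fun k => xhat k ω) - f₀) / f₀ ≤ ε}
        = P.real {ω | G ω ≤ ε} := by
      refine measureReal_congr ?_
      filter_upwards [hae] with ω hω
      refine propext ?_
      change (lsObjective A b (vectorAverage fun k => xhat k ω) - f₀) / f₀ ≤ ε ↔ G ω ≤ ε
      rw [hω, add_sub_cancel_left, mul_div_cancel_left₀ _ hpos.ne']
    rw [h2]
    refine le_trans (le_of_eq ?_) h1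
    rw [hGmean]
    have hq' : (q : ℝ) ≠ 0 := by positivity
    field_simp

end Average


/-! ### Reasoning about programs -/

/-- From the state `σ`, the program `c` takes at most `T` steps and ends in a state satisfying
`Q`. -/
def Runs (σ : State) (c : Cmd) (T : ℕ) (Q : State → Prop) : Prop :=
  Q (c.exec σ).1 ∧ (c.exec σ).2 ≤ T

section Rules

variable {σ : State} {Q Q' : State → Prop} {T T' : ℕ}

lemma Runs.mono {c : Cmd} (h : Runs σ c T Q) (hT : T ≤ T') (hQ : ∀ τ, Q τ → Q' τ) :
    Runs σ c T' Q' :=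
  ⟨hQ _ h.1, h.2.trans hT⟩

lemma Runs.idxConst {r c : ℕ} (h : Q (σ.setIdx r c)) : Runs σ (.idxConst r c) 1 Q :=
  ⟨h, le_rfl⟩

lemma Runs.idxAdd {r s t : ℕ} (h : Q (σ.setIdx r (σ.idx s + σ.idx t))) :
    Runs σ (.idxAdd r s t) 1 Q :=
  ⟨h, le_rfl⟩

lemma Runs.const {x : Cell} {c : ℚ} (h : Q (σ.set x c)) : Runs σ (.const x c) 1 Q :=
  ⟨h, le_rfl⟩

lemma Runs.arith {op : ArithOp} {x y z : Cell} (h : Q (σ.set x (op.eval (σ.get y) (σ.get z)))) :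
    Runs σ (.arith op x y z) 1 Q :=
  ⟨h, le_rfl⟩

lemma Runs.seq {c₁ c₂ : Cmd} (h : Runs σ c₁ T fun τ => Runs τ c₂ T' Q) :
    Runs σ (.seq c₁ c₂) (T + T') Q :=
  ⟨h.1.1, Nat.add_le_add h.2 h.1.2⟩

/-- The loop rule, with an invariant `I i` that holds before the `i`-th iteration. -/
lemma Runs.loop {r s : ℕ} {c : Cmd} (I : ℕ → State → Prop) (h0 : I 0 σ)
    (hstep : ∀ i < σ.idx s, ∀ τ, I i τ → Runs (τ.setIdx r i) c T (I (i + 1)))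
    (hQ : ∀ τ, I (σ.idx s) τ → Q τ) :
    Runs σ (.loop r s c) (1 + σ.idx s * (T + 1)) Q := by
  suffices h : ∀ N ≤ σ.idx s,
      I N (iter (fun i p => ((c.exec (p.1.setIdx r i)).1, p.2 + (c.exec (p.1.setIdx r i)).2 + 1))
        N (σ, 1)).1 ∧
      (iter (fun i p => ((c.exec (p.1.setIdx r i)).1, p.2 + (c.exec (p.1.setIdx r i)).2 + 1))
        N (σ, 1)).2 ≤ 1 + N * (T + 1) by
    exact ⟨hQ _ (h _ le_rfl).1, (h _ le_rfl).2⟩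
  intro N hN
  induction N with
  | zero => exact ⟨h0, by simp [iter]⟩
  | succ N ih =>
    obtain ⟨h1, h2⟩ := ih (by omega)
    obtain ⟨h3, h4⟩ := hstep N (by omega) _ h1
    refine ⟨h3, ?_⟩
    simp only [iter]
    rw [Nat.add_mul]
    omega

end Rules

/-! ### Gram-Schmidt elimination on arrays -/

/-- The inner product of the columns `i` and `j` of an array, over the first `m` rows. -/
noncomputable def colDot (m : ℕ) (X : ℕ → ℕ → ℝ) (i j : ℕ) : ℝ :=
  ∑ a ∈ Finset.range m, X a i * X a j

/-- Subtract from column `j` of the array, on its first `N` rows, the multiple of column `i` that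
makes it orthogonal to column `i` on the first `m` rows. -/
noncomputable def elimColumn (m N : ℕ) (i j : ℕ) (X : ℕ → ℕ → ℝ) (a k : ℕ) : ℝ :=
  if k = j ∧ a < N then X a j - colDot m X i j / colDot m X i i * X a i else X a k

/-- Orthogonalize column `j` against the columns `0, …, i - 1` in this order. -/
noncomputable def elimColumns (m N j i : ℕ) (X : ℕ → ℕ → ℝ) : ℕ → ℕ → ℝ :=
  iter (fun i X => elimColumn m N i j X) i X

/-- Gram-Schmidt orthogonalization, without normalization, of the first `J` columns. -/
noncomputable def gramSchmidtArray (m N J : ℕ) (X : ℕ → ℕ → ℝ) : ℕ → ℕ → ℝ :=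
  iter (fun j X => elimColumns m N j j X) J X

section GramSchmidt

variable {m N : ℕ}

lemma elimColumn_of_ne {i j k : ℕ} (hk : k ≠ j) (X : ℕ → ℕ → ℝ) (a : ℕ) :
    elimColumn m N i j X a k = X a k := by
  simp [elimColumn, hk]

lemma elimColumn_self {i j a : ℕ} (ha : a < N) (X : ℕ → ℕ → ℝ) :
    elimColumn m N i j X a j = X a j - colDot m X i j / colDot m X i i * X a i := by
  simp [elimColumn, ha]

lemma elimColumns_of_ne {i j k : ℕ} (hk : k ≠ j) (X : ℕ → ℕ → ℝ) (a : ℕ) :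
    elimColumns m N j i X a k = X a k := by
  induction i with
  | zero => rfl
  | succ i ih => exact (elimColumn_of_ne hk _ a).trans ih

lemma sum_mul_elimColumn (hmN : m ≤ N) (w : ℕ → ℝ) {i j : ℕ} (X : ℕ → ℕ → ℝ) :
    ∑ a ∈ Finset.range m, w a * elimColumn m N i j X a j
      = ∑ a ∈ Finset.range m, w a * X a j
        - colDot m X i j / colDot m X i i * ∑ a ∈ Finset.range m, w a * X a i := by
  rw [Finset.mul_sum, ← Finset.sum_sub_distrib]
  refine Finset.sum_congr rfl fun a ha => ?_
  rw [elimColumn_self ((Finset.mem_range.1 ha).trans_le hmN)]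
  ring

/-- If the pivot column vanishes, then the coefficient is the junk value `x / 0 = 0`, and the
columns are orthogonal anyway. -/
lemma colDot_elimColumn_self (hmN : m ≤ N) {i j : ℕ} (hij : i ≠ j) (X : ℕ → ℕ → ℝ) :
    colDot m (elimColumn m N i j X) i j = 0 := by
  have h := sum_mul_elimColumn hmN (fun a => X a i) (i := i) (j := j) X
  simp only [colDot, elimColumn_of_ne hij] at h ⊢
  rw [h]
  by_cases h0 : ∑ a ∈ Finset.range m, X a i * X a i = 0
  · rw [h0, mul_zero, sub_zero]
    have h1 := (Finset.sum_eq_zero_iff_of_nonneg fun a _ => mul_self_nonneg (X a i)).1 h0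
    exact Finset.sum_eq_zero fun a ha => by rw [mul_self_eq_zero.1 (h1 a ha), zero_mul]
  · rw [div_mul_cancel₀ _ h0, sub_self]

lemma colDot_elimColumn {i i' j : ℕ} (hmN : m ≤ N) (hi' : i' ≠ j) (X : ℕ → ℕ → ℝ)
    (h1 : colDot m X i' j = 0) (h2 : colDot m X i' i = 0) :
    colDot m (elimColumn m N i j X) i' j = 0 := by
  have h := sum_mul_elimColumn hmN (fun a => X a i') (i := i) (j := j) X
  simp only [colDot, elimColumn_of_ne hi'] at h h1 h2 ⊢
  rw [h, h1, h2]
  simp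

/-- The modified Gram-Schmidt process produces orthogonal columns if the previous ones are
orthogonal. -/
lemma colDot_elimColumns (hmN : m ≤ N) {j : ℕ} (X : ℕ → ℕ → ℝ)
    (hX : ∀ k < j, ∀ i < k, colDot m X i k = 0) (i : ℕ) (hi : i ≤ j) :
    ∀ i' < i, colDot m (elimColumns m N j i X) i' j = 0 := by
  induction i with
  | zero => simp
  | succ i ih =>
    intro i' hi'
    change colDot m (elimColumn m N i j (elimColumns m N j i X)) i' j = 0
    rcases Nat.lt_succ_iff_lt_or_eq.1 hi' with h | rfl
    · refine colDot_elimColumn hmN (by omega) _ (ih (by omega) i' h) ?_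
      have := hX i (by omega) i' h
      simpa only [colDot, elimColumns_of_ne (show i' ≠ j by omega),
        elimColumns_of_ne (show i ≠ j by omega)] using this
    · exact colDot_elimColumn_self hmN (by omega) _

lemma sum_mul_elimColumns (hmN : m ≤ N) (w : ℕ → ℝ) {j : ℕ} (X : ℕ → ℕ → ℝ) (i : ℕ) (hi : i ≤ j)
    (hw : ∀ k < i, ∑ a ∈ Finset.range m, w a * X a k = 0) :
    ∑ a ∈ Finset.range m, w a * elimColumns m N j i X a j
      = ∑ a ∈ Finset.range m, w a * X a j := by
  induction i with
  | zero => rfl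
  | succ i ih =>
    change ∑ a ∈ Finset.range m, w a * elimColumn m N i j (elimColumns m N j i X) a j = _
    rw [sum_mul_elimColumn hmN, ih (by omega) fun k hk => hw k (by omega)]
    simp only [elimColumns_of_ne (show i ≠ j by omega)]
    rw [hw i (by omega), mul_zero, sub_zero]

lemma gramSchmidtArray_of_le {J k : ℕ} (hk : J ≤ k) (X : ℕ → ℕ → ℝ) (a : ℕ) :
    gramSchmidtArray m N J X a k = X a k := by
  induction J with
  | zero => rfl
  | succ J ih => exact (elimColumns_of_ne (by omega) _ a).trans (ih (by omega))

lemma colDot_gramSchmidtArray (hmN : m ≤ N) (X : ℕ → ℕ → ℝ) (J : ℕ) :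
    ∀ j < J, ∀ i < j, colDot m (gramSchmidtArray m N J X) i j = 0 := by
  induction J with
  | zero => simp
  | succ J ih =>
    intro j hj i hi
    change colDot m (elimColumns m N J J (gramSchmidtArray m N J X)) i j = 0
    rcases Nat.lt_succ_iff_lt_or_eq.1 hj with h | rfl
    · have := ih j h i hi
      simpa only [colDot, elimColumns_of_ne (show i ≠ J by omega),
        elimColumns_of_ne (show j ≠ J by omega)] using this
    · exact colDot_elimColumns hmN _ ih j le_rfl i hi

/-- The span of the first columns is not diminished: what is orthogonal to the new columns is
orthogonal to the old ones. -/
lemma sum_mul_eq_zero_of_gramSchmidtArray (hmN : m ≤ N) (w : ℕ → ℝ) (X : ℕ → ℕ → ℝ) (J : ℕ)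
    (hw : ∀ k < J, ∑ a ∈ Finset.range m, w a * gramSchmidtArray m N J X a k = 0) :
    ∀ k < J, ∑ a ∈ Finset.range m, w a * X a k = 0 := by
  induction J with
  | zero => simp
  | succ J ih =>
    change ∀ k < J + 1, ∑ a ∈ Finset.range m,
      w a * elimColumns m N J J (gramSchmidtArray m N J X) a k = 0 at hw
    have h1 : ∀ k < J, ∑ a ∈ Finset.range m, w a * gramSchmidtArray m N J X a k = 0 := by
      intro k hk
      have := hw k (by omega)
      simpa only [elimColumns_of_ne (show k ≠ J by omega)] using this
    intro k hk
    rcases Nat.lt_succ_iff_lt_or_eq.1 hk with h | rfl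
    · exact ih h1 k h
    · have h2 := hw k (by omega)
      rw [sum_mul_elimColumns hmN w _ k le_rfl h1] at h2
      simpa only [gramSchmidtArray_of_le le_rfl] using h2

/-- Affine relations between the rows persist: if an entry of row `r` is a combination of the
entries of other rows in the same column, up to a term `y` in the column `d` alone, then this is
still so after column operations that never subtract column `d`. -/
lemma gramSchmidtArray_row_relation {d r : ℕ} (hr : r < N) {s : Finset ℕ}
    (hs : ∀ l ∈ s, l < N)
    (p : ℕ → ℝ) (y : ℝ) {X : ℕ → ℕ → ℝ}
    (hX : ∀ k ≤ d, X r k = ∑ l ∈ s, p l * X l k + if k = d then y else 0) (J : ℕ)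
    (hJ : J ≤ d + 1) : ∀ k ≤ d, gramSchmidtArray m N J X r k
      = ∑ l ∈ s, p l * gramSchmidtArray m N J X l k + if k = d then y else 0 := by
  have hstep (i j : ℕ) (hij : i < j) (hj : j ≤ d) (Y : ℕ → ℕ → ℝ)
      (hY : ∀ k ≤ d, Y r k = ∑ l ∈ s, p l * Y l k + if k = d then y else 0) :
      ∀ k ≤ d, elimColumn m N i j Y r k
        = ∑ l ∈ s, p l * elimColumn m N i j Y l k + if k = d then y else 0 := by
    intro k hk
    by_cases hkj : k = j
    · subst hkj
      rw [elimColumn_self hr, hY k hk, hY i (by omega), if_neg (show i ≠ d by omega), add_zero,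
        add_sub_right_comm, Finset.mul_sum, ← Finset.sum_sub_distrib]
      congr 1
      refine Finset.sum_congr rfl fun l hl => ?_
      rw [elimColumn_self (hs l hl)]
      ring
    · simp only [elimColumn_of_ne hkj]
      exact hY k hk
  induction J with
  | zero => exact hX
  | succ J ih =>
    suffices h : ∀ i ≤ J, ∀ k ≤ d, elimColumns m N J i (gramSchmidtArray m N J X) r k
        = ∑ l ∈ s, p l * elimColumns m N J i (gramSchmidtArray m N J X) l k
          + if k = d then y else 0 from h J le_rfl
    intro i hi
    induction i with
    | zero => exact ih (by omega)
    | succ i ih' => exact hstep i J (by omega) (by omega) _ (ih' (by omega))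

end GramSchmidt


/-! ### The worker program -/

section StateLemmas

variable (σ : State) (x : Cell) (v : ℝ) (r n : ℕ)

@[simp] lemma State.setIdx_idx (s : ℕ) :
    (σ.setIdx r n).idx s = if s = r then n else σ.idx s := by
  simp [State.setIdx, Function.update_apply]

@[simp] lemma State.setIdx_mem : (σ.setIdx r n).mem = σ.mem := rfl

@[simp] lemma State.set_idx : (σ.set x v).idx = σ.idx := rfl

lemma State.set_mem_of_ne {a : ℕ} (h : a ≠ x.arr) : (σ.set x v).mem a = σ.mem a := by
  ext i j
  simp [State.set, h]

lemma State.set_mem_self {a : ℕ} (h : a = x.arr) : (σ.set x v).mem a =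
    fun i j => if i = σ.idx x.row ∧ j = σ.idx x.col then v else σ.mem a i j := by
  ext i j
  simp [State.set, h]

end StateLemmas

/-- The program that orthogonalizes column `j` of array `0` against column `i`, where `i` and `j`
are the contents of the registers `5` and `4`. Registers: `0` holds the number `m` of rows that
enter the inner products, `3` the total number of rows, `6` is a row counter and `7` holds zero.
The inner product of the two columns, the squared norm of column `i`, a temporary scalar and the
quotient of the first two are kept in the arrays `3`, `4`, `5` and `6`. -/
def elimCmd : Cmd :=
  .seq (.const ⟨3, 7, 7⟩ 0) <|
  .seq (.const ⟨4, 7, 7⟩ 0) <|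
  .seq (.loop 6 0 <|
    .seq (.arith .mul ⟨5, 7, 7⟩ ⟨0, 6, 5⟩ ⟨0, 6, 4⟩) <|
    .seq (.arith .add ⟨3, 7, 7⟩ ⟨3, 7, 7⟩ ⟨5, 7, 7⟩) <|
    .seq (.arith .mul ⟨5, 7, 7⟩ ⟨0, 6, 5⟩ ⟨0, 6, 5⟩) <|
    .arith .add ⟨4, 7, 7⟩ ⟨4, 7, 7⟩ ⟨5, 7, 7⟩) <|
  .seq (.arith .div ⟨6, 7, 7⟩ ⟨3, 7, 7⟩ ⟨4, 7, 7⟩) <|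
  .loop 6 3 <|
    .seq (.arith .mul ⟨5, 7, 7⟩ ⟨6, 7, 7⟩ ⟨0, 6, 5⟩) <|
    .arith .sub ⟨0, 6, 4⟩ ⟨0, 6, 4⟩ ⟨5, 7, 7⟩

/-- The program of a worker. It appends the column `y` and below it and `M` the rows of `[I, 0]`,
orthogonalizes the columns of this array of `m + d` rows with respect to their first `m` entries,
and returns the negative of the last `d` entries of the last column. The cell of array `9` read
here is never written and holds zero. -/
def workerCmd : Cmd :=
  .seq (.idxConst 8 1) <|
  .seq (.idxAdd 2 1 8) <|
  .seq (.idxAdd 3 0 1) <|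
  .seq (.loop 6 0 <| .arith .add ⟨0, 6, 1⟩ ⟨1, 6, 7⟩ ⟨9, 7, 7⟩) <|
  .seq (.loop 6 1 <| .seq (.idxAdd 8 0 6) <| .const ⟨0, 8, 6⟩ 1) <|
  .seq (.loop 4 2 <| .loop 5 4 elimCmd) <|
  .loop 6 1 <| .seq (.idxAdd 8 0 6) <| .arith .sub ⟨2, 6, 7⟩ ⟨9, 7, 7⟩ ⟨0, 8, 1⟩

/-- The constants that the worker keeps. -/
structure WorkerConstants (m d : ℕ) (σ : State) : Prop where
  idx_zero : σ.idx 0 = m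
  idx_one : σ.idx 1 = d
  idx_two : σ.idx 2 = d + 1
  idx_three : σ.idx 3 = m + d
  idx_seven : σ.idx 7 = 0
  mem_nine : σ.mem 9 0 0 = 0

lemma WorkerConstants.setIdx {m d : ℕ} {σ : State} (h : WorkerConstants m d σ) {r n : ℕ}
    (hr : r = 4 ∨ r = 5 ∨ r = 6 ∨ r = 8) : WorkerConstants m d (σ.setIdx r n) := by
  obtain ⟨h0, h1, h2, h3, h7, h9⟩ := h
  rcases hr with rfl | rfl | rfl | rfl <;> constructor <;> simpa

lemma WorkerConstants.set {m d : ℕ} {σ : State} (h : WorkerConstants m d σ) {x : Cell} {v : ℝ}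
    (hx : x.arr ≠ 9) : WorkerConstants m d (σ.set x v) := by
  obtain ⟨h0, h1, h2, h3, h7, h9⟩ := h
  constructor <;> simpa [State.set_mem_of_ne _ _ _ hx.symm]

lemma runs_elimCmd {m d i j : ℕ} (hij : i < j) {X : ℕ → ℕ → ℝ} {σ : State}
    (hσ : WorkerConstants m d σ) (h4 : σ.idx 4 = j) (h5 : σ.idx 5 = i) (hX : σ.mem 0 = X) :
    Runs σ elimCmd (8 * m + 3 * d + 5) fun τ =>
      WorkerConstants m d τ ∧ τ.idx 4 = j ∧ τ.mem 0 = elimColumn m (m + d) i j X := by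
  -- The number of steps in the shape in which the rules produce it.
  refine Runs.mono (T := 1 + (1 + ((1 + m * (4 + 1)) + (1 + (1 + (m + d) * (2 + 1))))))
    (Q := fun τ => WorkerConstants m d τ ∧ τ.idx 4 = j ∧ τ.mem 0 = elimColumn m (m + d) i j X)
    ?_ (by ring_nf; omega) fun _ h => h
  refine .seq (.const (.seq (.const (.seq ?_))))
  -- The two inner products.
  have hloop₁ := Runs.loop (σ := (σ.set ⟨3, 7, 7⟩ ((0 : ℚ) : ℝ)).set ⟨4, 7, 7⟩ ((0 : ℚ) : ℝ))
    (r := 6) (s := 0) (T := 4)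
    (c := .seq (.arith .mul ⟨5, 7, 7⟩ ⟨0, 6, 5⟩ ⟨0, 6, 4⟩) <|
      .seq (.arith .add ⟨3, 7, 7⟩ ⟨3, 7, 7⟩ ⟨5, 7, 7⟩) <|
      .seq (.arith .mul ⟨5, 7, 7⟩ ⟨0, 6, 5⟩ ⟨0, 6, 5⟩) <|
      .arith .add ⟨4, 7, 7⟩ ⟨4, 7, 7⟩ ⟨5, 7, 7⟩)
    (fun a τ => WorkerConstants m d τ ∧ τ.idx 4 = j ∧ τ.idx 5 = i ∧ τ.mem 0 = X ∧
      τ.mem 3 0 0 = colDot a X i j ∧ τ.mem 4 0 0 = colDot a X i i)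
    (Q := fun τ => WorkerConstants m d τ ∧ τ.idx 4 = j ∧ τ.idx 5 = i ∧ τ.mem 0 = X ∧
      τ.mem 3 0 0 = colDot m X i j ∧ τ.mem 4 0 0 = colDot m X i i)
    ⟨(hσ.set (by simp)).set (by simp), h4, h5,
      by simp [State.set_mem_of_ne, hX],
      by simp [State.set_mem_of_ne, State.set_mem_self, hσ.idx_seven, colDot],
      by simp [State.set_mem_self, hσ.idx_seven, colDot]⟩
    (by
      rintro a - τ ⟨hτ, h4, h5, hX, h1, h2⟩
      refine .seq (.arith (.seq (.arith (.seq (.arith (.arith ?_))))))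
      refine ⟨?_, by simpa, by simpa, by simpa [State.set_mem_of_ne], ?_, ?_⟩
      · exact ((((hτ.setIdx (by simp)).set (by simp)).set (by simp)).set (by simp)).set (by simp)
      · simp [State.set_mem_of_ne, State.set_mem_self, State.get, ArithOp.eval, hτ.idx_seven, h1,
          h4, h5, hX, colDot, Finset.sum_range_succ]
      · simp [State.set_mem_of_ne, State.set_mem_self, State.get, ArithOp.eval, hτ.idx_seven, h2,
          h5, hX, colDot, Finset.sum_range_succ])
    (by
      intro τ h
      rwa [show ((σ.set ⟨3, 7, 7⟩ ((0 : ℚ) : ℝ)).set ⟨4, 7, 7⟩ ((0 : ℚ) : ℝ)).idx 0 = m from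
        hσ.idx_zero] at h)
  rw [show ((σ.set ⟨3, 7, 7⟩ ((0 : ℚ) : ℝ)).set ⟨4, 7, 7⟩ ((0 : ℚ) : ℝ)).idx 0 = m from
        hσ.idx_zero] at hloop₁
  refine hloop₁.mono le_rfl ?_
  clear hloop₁ hσ h4 h5 hX
  rintro σ ⟨hσ, h4, h5, hX, h1, h2⟩
  refine .seq (.arith ?_)
  set c := colDot m X i j / colDot m X i i with hc
  set σ' := σ.set ⟨6, 7, 7⟩ (ArithOp.div.eval (σ.get ⟨3, 7, 7⟩) (σ.get ⟨4, 7, 7⟩)) with hσ'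
  have h6 : σ'.mem 6 0 0 = c := by
    simp [hσ', State.set_mem_self, State.get, ArithOp.eval, hσ.idx_seven, h1, h2, hc]
  have hX' : σ'.mem 0 = X := by simp [hσ', State.set_mem_of_ne, hX]
  have hσ'c : WorkerConstants m d σ' := hσ.set (by simp)
  -- The update of the column.
  have h3 := hσ'c.idx_three
  have hloop₂ := Runs.loop (σ := σ') (r := 6) (s := 3) (T := 2)
    (c := .seq (.arith .mul ⟨5, 7, 7⟩ ⟨6, 7, 7⟩ ⟨0, 6, 5⟩) <|
      .arith .sub ⟨0, 6, 4⟩ ⟨0, 6, 4⟩ ⟨5, 7, 7⟩)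
    (fun N τ => WorkerConstants m d τ ∧ τ.idx 4 = j ∧ τ.idx 5 = i ∧ τ.mem 6 0 0 = c ∧
      τ.mem 0 = elimColumn m N i j X)
    (Q := fun τ => WorkerConstants m d τ ∧ τ.idx 4 = j ∧
      τ.mem 0 = elimColumn m (m + d) i j X)
    ⟨hσ'c, h4, h5, h6, by rw [hX']; ext a k; simp [elimColumn]⟩
    (by
      rintro a - τ ⟨hτ, h4, h5, h6, hX⟩
      refine .seq (.arith (.arith ?_))
      refine ⟨?_, by simpa, by simpa, by simpa [State.set_mem_of_ne], ?_⟩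
      · exact ((hτ.setIdx (by simp)).set (by simp)).set (by simp)
      · have hij' : i ≠ j := by omega
        have hmem (u : ℝ) : ((τ.setIdx 6 a).set ⟨5, 7, 7⟩ u).mem 0 = elimColumn m a i j X := by
          rw [State.set_mem_of_ne _ _ _ (by simp), State.setIdx_mem, hX]
        ext b k
        simp only [State.set_mem_self, State.get, ArithOp.eval, hmem, hτ.idx_seven, h4, h5, hX,
          State.set_idx, State.setIdx_idx, State.setIdx_mem, elimColumn, ← hc]
        by_cases hk : k = j
        · subst hk
          rcases lt_trichotomy b a with hb | rfl | hb
          · simp [hb, hb.ne, hb.trans (Nat.lt_succ_self a)]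
          · simp [hij', h6]
          · simp [hb.ne', hb.not_gt, show ¬ b < a + 1 by omega]
        · simp [hk])
    (by
      rintro τ ⟨hτ, h4, -, -, hX⟩
      exact ⟨hτ, h4, by rw [hX, h3]⟩)
  rwa [h3] at hloop₂

/-- The array `[M, y; I, 0]` that the worker orthogonalizes, padded with zeros. -/
noncomputable def stackedArray {m d : ℕ} (M : Matrix (Fin m) (Fin d) ℝ) (y : Fin m → ℝ) (i k : ℕ) :
    ℝ :=
  if k < d ∧ i = m + k then 1
  else if k = d ∧ i < m then vectorArray y i 0 else matrixArray M i k

lemma runs_workerCmd {m d : ℕ} (M : Matrix (Fin m) (Fin d) ℝ) (y : Fin m → ℝ) :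
    Runs (workerInput M y) workerCmd
      (3 + (1 + m * 2) + (1 + d * 3) + (1 + (d + 1) * (2 + d * (8 * m + 3 * d + 6))) +
        (1 + d * 3)) fun τ => ∀ l < d,
          τ.mem 2 l 0 = -gramSchmidtArray m (m + d) (d + 1) (stackedArray M y) (m + l) d := by
  -- The number of steps in the shape in which the rules produce it.
  refine Runs.mono (T := 1 + (1 + (1 + ((1 + m * (1 + 1)) + ((1 + d * (2 + 1)) +
    ((1 + (d + 1) * ((1 + d * ((8 * m + 3 * d + 5) + 1)) + 1)) + (1 + d * (2 + 1))))))))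
    ?_ (by ring_nf; omega) fun _ h => h
  refine .seq (.idxConst (.seq (.idxAdd (.seq (.idxAdd (.seq ?_))))))
  set σ := (((workerInput M y).setIdx 8 1).setIdx 2
    (((workerInput M y).setIdx 8 1).idx 1 + ((workerInput M y).setIdx 8 1).idx 8)).setIdx 3 _
    with hσ
  have hσc : WorkerConstants m d σ := by
    constructor <;> simp [hσ, workerInput, sizeRegisters]
  have hM : σ.mem 0 = matrixArray M := rfl
  have hy : σ.mem 1 = vectorArray y := rfl
  clear_value σ
  -- Appending the column `y`.
  have h0 := hσc.idx_zero
  have hloop₁ := Runs.loop (σ := σ) (r := 6) (s := 0) (T := 1)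
    (c := .arith .add ⟨0, 6, 1⟩ ⟨1, 6, 7⟩ ⟨9, 7, 7⟩)
    (fun a τ => WorkerConstants m d τ ∧ τ.mem 1 = vectorArray y ∧
      τ.mem 0 = fun i k => if k = d ∧ i < a then vectorArray y i 0 else matrixArray M i k)
    ⟨hσc, hy, by simp [hM]⟩
    (by
      rintro a - τ ⟨hτ, hy, hM⟩
      refine .arith ⟨(hτ.setIdx (by simp)).set (by simp), by simpa [State.set_mem_of_ne], ?_⟩
      ext i k
      simp only [State.set_mem_self, State.get, ArithOp.eval, hτ.idx_seven, hτ.idx_one,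
        hy, hM, State.setIdx_idx, State.setIdx_mem]
      by_cases hk : k = d
      · subst hk
        rcases lt_trichotomy i a with hb | rfl | hb
        · simp [hb, hb.ne, hb.trans (Nat.lt_succ_self a)]
        · simp [hτ.mem_nine]
        · simp [hb.ne', hb.not_gt, show ¬ i < a + 1 by omega]
      · simp [hk])
    (fun _ h => h)
  rw [h0] at hloop₁
  refine hloop₁.mono le_rfl ?_
  clear! σ
  rintro σ ⟨hσ, -, hM⟩
  refine .seq ?_
  -- Appending the identity.
  have h1 := hσ.idx_one
  have hloop₂ := Runs.loop (σ := σ) (r := 6) (s := 1) (T := 2)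
    (c := .seq (.idxAdd 8 0 6) <| .const ⟨0, 8, 6⟩ 1)
    (fun a τ => WorkerConstants m d τ ∧
      τ.mem 0 = fun i k => if k < a ∧ i = m + k then 1
        else if k = d ∧ i < m then vectorArray y i 0 else matrixArray M i k)
    ⟨hσ, by simp [hM]⟩
    (by
      rintro a - τ ⟨hτ, hM⟩
      refine .seq (.idxAdd (.const ⟨((hτ.setIdx (by simp)).setIdx (by simp)).set (by simp), ?_⟩))
      ext i k
      simp only [State.set_mem_self, hτ.idx_zero, hM, State.setIdx_idx, State.setIdx_mem]
      rcases lt_trichotomy k a with hb | rfl | hb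
      · simp [hb, hb.ne, hb.trans (Nat.lt_succ_self a)]
      · by_cases hi : i = m + k <;> simp [hi]
      · simp [hb.ne', hb.not_gt, show ¬ k < a + 1 by omega])
    (fun _ h => h)
  rw [h1] at hloop₂
  refine hloop₂.mono le_rfl ?_
  clear! σ
  rintro σ ⟨hσ, hX⟩
  change σ.mem 0 = stackedArray M y at hX
  refine .seq ?_
  -- Orthogonalization.
  have h2 := hσ.idx_two
  have hloop₃ := Runs.loop (σ := σ) (r := 4) (s := 2)
    (T := 1 + d * ((8 * m + 3 * d + 5) + 1)) (c := .loop 5 4 elimCmd)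
    (fun J τ => WorkerConstants m d τ ∧
      τ.mem 0 = gramSchmidtArray m (m + d) J (stackedArray M y))
    ⟨hσ, hX⟩
    (by
      rintro j hj τ ⟨hτ, hX⟩
      have hj4 : (τ.setIdx 4 j).idx 4 = j := by simp
      have hinner := Runs.loop (σ := τ.setIdx 4 j) (r := 5) (s := 4)
        (T := 8 * m + 3 * d + 5) (c := elimCmd)
        (fun i τ => WorkerConstants m d τ ∧ τ.idx 4 = j ∧ τ.mem 0 =
          elimColumns m (m + d) j i (gramSchmidtArray m (m + d) j (stackedArray M y)))
        ⟨hτ.setIdx (by simp), hj4, hX⟩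
        (by
          rintro i hi ρ ⟨hρ, hρ4, hX⟩
          rw [hj4] at hi
          exact runs_elimCmd hi (hρ.setIdx (by simp)) (by simpa) (by simp) hX)
        (fun _ h => h)
      rw [hj4] at hinner
      refine hinner.mono ?_ fun ρ ⟨hρ, _, hX⟩ => ⟨hρ, hX⟩
      gcongr
      omega)
    (fun _ h => h)
  rw [h2] at hloop₃
  refine hloop₃.mono le_rfl ?_
  clear! σ
  rintro σ ⟨hσ, hX⟩
  -- Output.
  have h1 := hσ.idx_one
  have hloop₄ := Runs.loop (σ := σ) (r := 6) (s := 1) (T := 2)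
    (c := .seq (.idxAdd 8 0 6) <| .arith .sub ⟨2, 6, 7⟩ ⟨9, 7, 7⟩ ⟨0, 8, 1⟩)
    (fun a τ => WorkerConstants m d τ ∧
      τ.mem 0 = gramSchmidtArray m (m + d) (d + 1) (stackedArray M y) ∧
      ∀ l < a, τ.mem 2 l 0
        = -gramSchmidtArray m (m + d) (d + 1) (stackedArray M y) (m + l) d)
    ⟨hσ, hX, by simp⟩
    (by
      rintro a - τ ⟨hτ, hX, hout⟩
      refine .seq (.idxAdd (.arith ⟨((hτ.setIdx (by simp)).setIdx (by simp)).set (by simp),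
        by simpa [State.set_mem_of_ne], fun l hl => ?_⟩))
      simp only [State.set_mem_self, hτ.idx_zero, hτ.idx_one, hτ.idx_seven, hX,
        State.setIdx_idx, State.setIdx_mem, State.get, ArithOp.eval]
      rcases Nat.lt_succ_iff_lt_or_eq.1 hl with h | rfl
      · simp [h.ne, hout l h]
      · simp [hτ.mem_nine])
    (fun _ h => h)
  rw [h1] at hloop₄
  exact hloop₄.mono le_rfl fun τ h => h.2.2

/-- The last column of the orthogonalized array is the residual `y - M x` on top of `-x`. It is
orthogonal to the other columns, hence to the columns of `M`. -/
lemma isLeastSquaresSolution_gramSchmidtArray {m d : ℕ} (M : Matrix (Fin m) (Fin d) ℝ)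
    (y : Fin m → ℝ) :
    IsLeastSquaresSolution M y fun l =>
      -gramSchmidtArray m (m + d) (d + 1) (stackedArray M y) (m + l) d := by
  set X := gramSchmidtArray m (m + d) (d + 1) (stackedArray M y) with hX
  have hrow (a : Fin m) : X a d = y a - M.mulVec (fun l : Fin d => -X (m + l) d) a := by
    have h := gramSchmidtArray_row_relation (m := m) (N := m + d) (d := d) (r := a) (by omega)
      (s := (Finset.range d).map (addLeftEmbedding m)) (by simp)
      (fun l => matrixArray M a (l - m)) (y a) (X := stackedArray M y)
      (by
        intro k hk
        simp only [Finset.sum_map, addLeftEmbedding_apply, add_tsub_cancel_left]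
        rcases hk.lt_or_eq with hk | rfl
        · rw [Finset.sum_eq_single k]
          · simp [stackedArray, hk, hk.ne, show (a : ℕ) ≠ m + k by omega]
          · intro l hl hlk
            have hl' := Finset.mem_range.1 hl
            simp [stackedArray, hk.ne, hlk, matrixArray]
          · simp [hk]
        · rw [Finset.sum_eq_zero]
          · simp [stackedArray, vectorArray]
          · intro l hl
            simp [stackedArray, matrixArray])
      (d + 1) le_rfl d le_rfl
    rw [← hX] at h
    rw [h, if_pos rfl, add_comm, Finset.sum_map, Finset.sum_range]
    simp only [addLeftEmbedding_apply, add_tsub_cancel_left, Matrix.mulVec, dotProduct,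
      mul_neg, Finset.sum_neg_distrib, sub_neg_eq_add]
    simp [matrixArray]
  have horth (i : Fin d) : ∑ a : Fin m, X a d * M a i = 0 := by
    have h := sum_mul_eq_zero_of_gramSchmidtArray (Nat.le_add_right m d) (fun a => X a d)
      (stackedArray M y) d
      (by
        intro k hk
        have h := colDot_gramSchmidtArray (Nat.le_add_right m d) (stackedArray M y) (d + 1) d
          (by omega) k hk
        rw [← hX] at h
        have hk' (a : ℕ) : gramSchmidtArray m (m + d) d (stackedArray M y) a k = X a k :=
          (elimColumns_of_ne hk.ne _ a).symm
        simp only [hk']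
        simpa only [colDot, mul_comm] using h) i i.2
    rw [Finset.sum_range] at h
    rw [← h]
    refine Finset.sum_congr rfl fun a _ => ?_
    simp [stackedArray, matrixArray, i.2.ne, show (a : ℕ) ≠ m + i by omega]
  rw [isLeastSquaresSolution_iff]
  intro z
  have hres : M.mulVec (fun l : Fin d => -X (m + l) d) - y = fun a : Fin m => -X a d := by
    ext a
    rw [hrow a, Pi.sub_apply]
    ring
  rw [hres, Matrix.dotProduct_mulVec]
  have hz : Matrix.vecMul (fun a : Fin m => -X a d) M = 0 := by
    ext i
    simp only [Matrix.vecMul, dotProduct, neg_mul, Finset.sum_neg_distrib, horth, neg_zero,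
      Pi.zero_apply]
  rw [hz, zero_dotProduct]

lemma isLeastSquaresSolution_workerOutput {m d : ℕ} (M : Matrix (Fin m) (Fin d) ℝ)
    (y : Fin m → ℝ) : IsLeastSquaresSolution M y (workerOutput workerCmd M y) := by
  have h : workerOutput workerCmd M y = fun l : Fin d =>
      -gramSchmidtArray m (m + d) (d + 1) (stackedArray M y) (m + l) d :=
    funext fun l => (runs_workerCmd M y).1 l l.2
  rw [h]
  exact isLeastSquaresSolution_gramSchmidtArray M y

lemma workerTime_le {m d : ℕ} (hd : 0 < d) (hdm : d ≤ m) (M : Matrix (Fin m) (Fin d) ℝ)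
    (y : Fin m → ℝ) : workerTime workerCmd M y ≤ 60 * (m * d ^ 2) := by
  refine (runs_workerCmd M y).2.trans ?_
  have hm : 0 < m := hd.trans_le hdm
  have h1 : m * 1 ≤ m * d ^ 2 := Nat.mul_le_mul_left m (Nat.one_le_pow _ _ hd)
  have h2 : 8 * m + 3 * d + 6 ≤ 17 * m := by omega
  have h3 : 2 + d * (8 * m + 3 * d + 6) ≤ 19 * (d * m) := by
    have := Nat.mul_le_mul_left d h2
    have := Nat.mul_pos hd hm
    have h4 : d * (17 * m) = 17 * (d * m) := by ring
    omega
  have h5 : (d + 1) * (2 + d * (8 * m + 3 * d + 6)) ≤ (2 * d) * (19 * (d * m)) :=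
    Nat.mul_le_mul (by omega) h3
  have h6 : (2 * d) * (19 * (d * m)) = 38 * (m * d ^ 2) := by ring
  omega

/-! ### The master program -/

/-- The program of the master node: it obtains the real number `q` by counting, in array `3`, and
then averages column by column. Array `4` holds the constant one. -/
def masterCmd : Cmd :=
  .seq (.const ⟨4, 7, 7⟩ 1) <|
  .seq (.loop 6 0 <| .arith .add ⟨3, 7, 7⟩ ⟨3, 7, 7⟩ ⟨4, 7, 7⟩) <|
  .loop 4 1 <|
    .seq (.loop 5 0 <| .arith .add ⟨2, 4, 7⟩ ⟨2, 4, 7⟩ ⟨0, 5, 4⟩) <|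
    .arith .div ⟨2, 4, 7⟩ ⟨2, 4, 7⟩ ⟨3, 7, 7⟩

lemma runs_masterCmd {q d : ℕ} (x : Fin q → Fin d → ℝ) :
    Runs (masterInput x) masterCmd (1 + ((1 + q * (1 + 1)) + (1 + d * ((1 + q * (1 + 1) + 1) + 1))))
      fun τ => ∀ l < d,
        τ.mem 2 l 0 = (∑ k ∈ Finset.range q, matrixArray (Matrix.of x) k l) / q := by
  refine .seq (.const (.seq ?_))
  set σ := (masterInput x).set ⟨4, 7, 7⟩ ((1 : ℚ) : ℝ) with hσ
  have h0 : σ.idx 0 = q := rfl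
  have h1 : σ.idx 1 = d := rfl
  have h7 : σ.idx 7 = 0 := rfl
  have hm0 : σ.mem 0 = matrixArray (Matrix.of x) := by
    simp [hσ, State.set_mem_of_ne, masterInput]
  have hm2 : σ.mem 2 = fun _ _ => 0 := by
    simp [hσ, State.set_mem_of_ne, masterInput]
  have hm3 : σ.mem 3 0 0 = 0 := by
    simp [hσ, State.set_mem_of_ne, masterInput]
  have hm4 : σ.mem 4 0 0 = 1 := by
    simp [hσ, State.set_mem_self, masterInput, sizeRegisters]
  clear_value σ
  have hloop₁ := Runs.loop (σ := σ) (r := 6) (s := 0) (T := 1)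
    (c := .arith .add ⟨3, 7, 7⟩ ⟨3, 7, 7⟩ ⟨4, 7, 7⟩)
    (fun a τ => τ.idx 0 = q ∧ τ.idx 1 = d ∧ τ.idx 7 = 0 ∧
      τ.mem 0 = matrixArray (Matrix.of x) ∧ τ.mem 2 = (fun _ _ => 0) ∧ τ.mem 4 0 0 = 1 ∧
      τ.mem 3 0 0 = a)
    ⟨h0, h1, h7, hm0, hm2, hm4, by simpa⟩
    (by
      rintro a - τ ⟨h0, h1, h7, hm0, hm2, hm4, hm3⟩
      refine .arith ⟨by simpa, by simpa, by simpa, by simpa [State.set_mem_of_ne],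
        by simpa [State.set_mem_of_ne], by simpa [State.set_mem_of_ne], ?_⟩
      simp [State.set_mem_self, State.get, ArithOp.eval, h7, hm3, hm4])
    (fun _ h => h)
  rw [h0] at hloop₁
  refine hloop₁.mono le_rfl ?_
  clear! σ
  rintro σ ⟨h0, h1, h7, hm0, hm2, -, hm3⟩
  set s : ℕ → ℕ → ℝ := fun N l => ∑ k ∈ Finset.range N, matrixArray (Matrix.of x) k l with hs
  have hloop₂ := Runs.loop (σ := σ) (r := 4) (s := 1) (T := 1 + q * (1 + 1) + 1)
    (c := .seq (.loop 5 0 <| .arith .add ⟨2, 4, 7⟩ ⟨2, 4, 7⟩ ⟨0, 5, 4⟩) <|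
      .arith .div ⟨2, 4, 7⟩ ⟨2, 4, 7⟩ ⟨3, 7, 7⟩)
    (fun j τ => τ.idx 0 = q ∧ τ.idx 7 = 0 ∧ τ.mem 0 = matrixArray (Matrix.of x) ∧
      τ.mem 3 0 0 = q ∧ ∀ l, τ.mem 2 l 0 = if l < j then s q l / q else 0)
    ⟨h0, h7, hm0, hm3, by simp [hm2]⟩
    (by
      rintro j - τ ⟨h0, h7, hm0, hm3, hm2⟩
      have hτ0 : (τ.setIdx 4 j).idx 0 = q := by simpa
      have hinner := Runs.loop (σ := τ.setIdx 4 j) (r := 5) (s := 0) (T := 1)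
        (c := .arith .add ⟨2, 4, 7⟩ ⟨2, 4, 7⟩ ⟨0, 5, 4⟩)
        (fun N τ => τ.idx 0 = q ∧ τ.idx 4 = j ∧ τ.idx 7 = 0 ∧
          τ.mem 0 = matrixArray (Matrix.of x) ∧ τ.mem 3 0 0 = q ∧
          ∀ l, τ.mem 2 l 0 = if l < j then s q l / q else if l = j then s N l else 0)
        ⟨by simpa, by simp, by simpa, by simpa, by simpa, by
          intro l
          rw [State.setIdx_mem, hm2]
          simp [hs]⟩
        (by
          rintro N - ρ ⟨h0, h4, h7, hm0, hm3, hm2⟩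
          refine .arith ⟨by simpa, by simpa, by simpa, by simpa [State.set_mem_of_ne],
            by simpa [State.set_mem_of_ne], fun l => ?_⟩
          simp only [State.set_mem_self, State.get, ArithOp.eval, State.setIdx_idx,
            State.setIdx_mem, h4, h7, hm0, hm2]
          rcases lt_trichotomy l j with h | rfl | h
          · simp [h, h.ne]
          · simp [hs, hm2, Finset.sum_range_succ]
          · simp [h.ne', h.not_gt])
        (fun _ h => h)
      rw [hτ0] at hinner
      refine .seq (hinner.mono le_rfl ?_)
      rintro ρ ⟨h0, h4, h7, hm0, hm3, hm2⟩
      refine .arith ⟨by simpa, by simpa, by simpa [State.set_mem_of_ne],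
        by simpa [State.set_mem_of_ne], fun l => ?_⟩
      simp only [State.set_mem_self, State.get, ArithOp.eval, h4, h7, hm3, hm2]
      rcases lt_trichotomy l j with h | rfl | h
      · simp [h, h.ne, h.trans (Nat.lt_succ_self j)]
      · simp
      · simp [h.ne', h.not_gt, show ¬ l < j + 1 by omega])
    (fun _ h => h)
  rw [h1] at hloop₂
  refine hloop₂.mono le_rfl fun τ h l hl => ?_
  rw [h.2.2.2.2 l, if_pos hl]

lemma masterOutput_eq {q d : ℕ} (x : Fin q → Fin d → ℝ) :
    masterOutput masterCmd x = vectorAverage x := by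
  ext l
  have h := (runs_masterCmd x).1 l l.2
  rw [Finset.sum_range] at h
  refine h.trans ?_
  simp [vectorAverage, matrixArray, div_eq_inv_mul]

lemma masterTime_le {q d : ℕ} (hq : 0 < q) (hd : 0 < d) (x : Fin q → Fin d → ℝ) :
    masterTime masterCmd x ≤ 60 * (q * d) := by
  refine (runs_masterCmd x).2.trans ?_
  have h1 : q * 1 ≤ q * d := Nat.mul_le_mul_left q hd
  have h2 : 1 * d ≤ q * d := Nat.mul_le_mul_right d hq
  have h3 : d * ((1 + q * (1 + 1) + 1) + 1) = 3 * d + 2 * (q * d) := by ring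
  omega

end Sketching

theorem mainTheorem1 :
    -- the algorithm and its running time
    (∃ (worker master : Sketching.Cmd) (C : ℕ),
      ∀ (m d q : ℕ), 0 < d → d ≤ m → 0 < q →
      ∀ (M : Fin q → Matrix (Fin m) (Fin d) ℝ) (y : Fin q → Fin m → ℝ),
        (∀ k, Sketching.IsLeastSquaresSolution (M k) (y k)
          (Sketching.workerOutput worker (M k) (y k))) ∧
        (∀ k, Sketching.workerTime worker (M k) (y k) ≤ C * (m * d ^ 2)) ∧
        Sketching.masterOutput master (fun k => Sketching.workerOutput worker (M k) (y k)) =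
          Sketching.vectorAverage (fun k => Sketching.workerOutput worker (M k) (y k)) ∧
        Sketching.masterTime master (fun k => Sketching.workerOutput worker (M k) (y k)) ≤
          C * (q * d)) ∧
    -- the error of the averaged solution
    (∀ (n d m q : ℕ) (A : Matrix (Fin n) (Fin d) ℝ) (b : Fin n → ℝ) (xstar : Fin d → ℝ)
      (Ω : Type*) [MeasurableSpace Ω] (P : Measure Ω) [IsProbabilityMeasure P]
      (S : Fin q → Ω → Matrix (Fin m) (Fin n) ℝ) (xhat : Fin q → Ω → Fin d → ℝ),
      A.rank = d → d + 1 < m → 0 < q →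
      Sketching.IsLeastSquaresSolution A b xstar →
      0 < Sketching.lsObjective A b xstar →
      Sketching.IsIIDGaussianSketches P S →
      (∀ k, ∀ᵐ ω ∂P,
        Sketching.IsLeastSquaresSolution (S k ω * A) ((S k ω).mulVec b) (xhat k ω)) →
      Integrable (fun ω => Sketching.lsObjective A b (Sketching.vectorAverage fun k => xhat k ω)) P ∧
      ((∫ ω, Sketching.lsObjective A b (Sketching.vectorAverage fun k => xhat k ω) ∂P) -
          Sketching.lsObjective A b xstar) / Sketching.lsObjective A b xstar =
        1 / (q : ℝ) * ((d : ℝ) / ((m : ℝ) - (d : ℝ) - 1)) ∧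
      ∀ ε : ℝ, 0 < ε →
        1 - 1 / ((q : ℝ) * ε) * ((d : ℝ) / ((m : ℝ) - (d : ℝ) - 1)) ≤
          P.real {ω | (Sketching.lsObjective A b (Sketching.vectorAverage fun k => xhat k ω) -
            Sketching.lsObjective A b xstar) / Sketching.lsObjective A b xstar ≤ ε}) := by
  refine ⟨⟨Sketching.workerCmd, Sketching.masterCmd, 60, ?_⟩, ?_⟩
  · intro m d q hd hdm hq M y
    exact ⟨fun k => Sketching.isLeastSquaresSolution_workerOutput (M k) (y k),
      fun k => Sketching.workerTime_le hd hdm (M k) (y k), Sketching.masterOutput_eq _,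
      Sketching.masterTime_le hq hd _⟩
  · intro n d m q A b xstar Ω _ P _ S xhat hA hm hq hx hpos hS hxhat
    exact Sketching.error_of_averaged_solution A b xstar xhat hA hm hq hx hpos hS hxhat
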